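/- **Model.** Let $d,u$ be reals with $0\le u\le d$. A system has $n\ge 1$ processes $p_0,\dots,p_{n-1}$. They are deterministic state machines; a step of a process is triggered by an operation invocation, the arrival of a message or the expiration of a timer, takes no time, and may change the state, send messages, set timers and generate a response. Processes have local clocks that run at the rate of real time, with an offset. Users invoke operations at a process only when no operation is pending there, and all arguments of $Enqueue$ in a run are different. A run is admissible if every message is received exactly once, with a delay in $[d-u,d]$, every timer expires exactly at its time, the offsets of any two local clocks differ by at most $(1-\frac1n)u$, and there are finitely many steps up to any time. An algorithm is *uniform* if its state machines do not depend on $n$ (they may depend on the process index, and on $d$ and $u$). **Multiplicity queue.** Let $V$ be an infinite set and $\bot\notin V$. A multiplicity queue over $V$ has the operations $Enqueue(x)$, $x\in V$, which returns nothing, and $Dequeue()$, which returns an element of $V\cup\{\bot\}$. A sequence of sets of operation instances is legal if (i) every $Enqueue$ instance is in a singleton set, (ii) all $Dequeue$ instances in the same set return the same value, and (iii) each $Dequeue$ instance returns the argument of the earliest $Enqueue$ instance that precedes it in the sequence and whose argument has not been returned by a $Dequeue$ instance preceding it, or $\bot$ if there is no such $Enqueue$ instance. **Implementations.** A uniform algorithm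 is a set-linearizable implementation of a multiplicity queue if for every $n\ge1$: in every admissible run each invocation has a matching response; for every admissible run there is a legal sequence of sets that contains every operation instance of the run exactly once and in which $op_1$ is in an earlier set than $op_2$ whenever $op_1$ returns before $op_2$ is invoked; and the algorithm is eventually quiescent, that is, after finitely many invocations it takes only finitely many steps, also in partial executions. Let $|Dequeue|\in[0,\infty]$ be the supremum, over all $n\ge 1$, all admissible runs with $n$ processes and all $Dequeue$ instances in them, of the real time between invocation and response. **Claim.** Every uniform set-linearizable implementation of a multiplicity queue over $V$ satisfies $$|Dequeue|\;\ge\;\frac{d+u}{2}\;\ge\;\min\left\{\frac{2d}{3},\frac{d+u}{2}\right\}.$$ -/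

import Mathlib

open scoped NNReal ENNReal

namespace MultiplicityQueue

universe v w

/-! ### The data type -/

/-- The invocations of a multiplicity queue over the value set `V`. -/
inductive Op (V : Type v) : Type v
  | enqueue (arg : V)
  | dequeue

/-- The responses: `ack` returns nothing, `value (some x)` returns `x`, and
`value none` returns the special value `⊥`. -/
inductive Response (V : Type v) : Type v
  | ack
  | value (ret : Option V)

/-- A (complete) operation instance: an invocation with a response of the right kind. -/
inductive OpInstance (V : Type v) : Type v
  | enqueue (arg : V)
  | dequeue (ret : Option V)

/-- Pair an invocation with a response; `none` if the response is of the wrong kind. -/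
def OpInstance.ofPair {V : Type v} : Op V → Response V → Option (OpInstance V)
  | .enqueue x, .ack => some (.enqueue x)
  | .dequeue, .value r => some (.dequeue r)
  | _, _ => none

/-- A sequence of sets of operation instances is given by a family `inst` of instances, indexed
by `ι`, with the position `pos a` of the set that contains the instance `a`; so the sets are the
fibres of `pos`. `Available inst pos a e x` says that `e` is an instance of `Enqueue(x)` which
precedes `a` and whose argument has not been returned by a `Dequeue` preceding `a`. -/
def Available {V : Type v} {ι : Type*} (inst : ι → OpInstance V) (pos : ι → ℕ)
    (a e : ι) (x : V) : Prop :=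
  inst e = .enqueue x ∧ pos e < pos a ∧ ∀ b, pos b < pos a → inst b ≠ .dequeue (some x)

/-- Legal sequences of sets of instances of a multiplicity queue. -/
structure IsLegal {V : Type v} {ι : Type*} (inst : ι → OpInstance V) (pos : ι → ℕ) : Prop where
  /-- every `Enqueue` instance is in a singleton set -/
  enqueue_singleton : ∀ a b x, inst a = .enqueue x → pos b = pos a → b = a
  /-- all `Dequeue` instances in the same set return the same value -/
  dequeue_agree : ∀ a b r r', inst a = .dequeue r → inst b = .dequeue r' → pos a = pos b → r = r'
  /-- a `Dequeue` returns the argument of the earliest available `Enqueue` ... -/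
  dequeue_some : ∀ a x, inst a = .dequeue (some x) →
    ∃ e, Available inst pos a e x ∧ ∀ e' x', Available inst pos a e' x' → pos e ≤ pos e'
  /-- ... and `⊥` only if there is none -/
  dequeue_none : ∀ a, inst a = .dequeue none → ∀ e x, ¬ Available inst pos a e x

/-! ### Algorithms -/

/-- What triggers a step of a state machine: an invocation, the arrival of a message (with the
index of its sender), or the expiration of a timer. -/
inductive Input (V : Type v) (Msg Timer : Type w) : Type (max v w)
  | invoke (op : Op V)
  | receive (src : ℕ) (m : Msg)
  | expire (τ : Timer)

/-- The effects of a step: the messages sent to each process, the timers set (with their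
durations), and possibly a response to the pending operation. -/
structure Output (V : Type v) (Msg Timer : Type w) : Type (max v w) where
  send : ℕ → List Msg
  timers : List (ℝ≥0 × Timer)
  response : Option (Response V)

/-- The step without effects. -/
def Output.empty {V : Type v} {Msg Timer : Type w} : Output V Msg Timer := ⟨fun _ => [], [], none⟩

/-- A uniform algorithm: a deterministic state machine for each process index `i : ℕ`, which does
not depend on the number `n` of processes. `step i s c inp` is the step of process `i` in state
`s`, at local clock value `c`, on input `inp`. In a system with `n` processes, whatever is sent
to an index `≥ n` has no recipient and disappears; so "send to all processes" is available. -/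
structure UniformAlgorithm (V : Type v) : Type (max v (w + 1)) where
  State : Type w
  Msg : Type w
  Timer : Type w
  init : ℕ → State
  step : ℕ → State → ℝ → Input V Msg Timer → State × Output V Msg Timer

/-! ### Runs -/

/-- `deliver j p`: arrival of the `p`-th message that event number `j` sent to this process.
`expire j p`: expiration of the `p`-th timer that event number `j` has set. -/
inductive Trigger (V : Type v) : Type v
  | invoke (op : Op V)
  | deliver (j p : ℕ)
  | expire (j p : ℕ)

/-- An event: a step of process `proc` at real time `time`. -/
structure Event (V : Type v) (n : ℕ) : Type v where
  proc : Fin n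
  time : ℝ
  trigger : Trigger V

/-- The timed events of the `n` processes, interleaved into one sequence (finite or infinite;
`none` is an unused number), and the offsets of the local clocks from real time. States and
outputs are computed from it by the algorithm. -/
structure Run (V : Type v) (n : ℕ) : Type v where
  offset : Fin n → ℝ
  event : ℕ → Option (Event V n)

variable {V : Type v} {n : ℕ}

/-- The input of the state machine at event `e`, given the outputs `out` of the earlier events. -/
def Run.input {Msg Timer : Type w} (R : Run V n) (out : ℕ → Output V Msg Timer) (e : Event V n) :
    Option (Input V Msg Timer) :=
  match e.trigger with
  | .invoke op => some (.invoke op)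
  | .deliver j p =>
    match R.event j with
    | some f => (((out j).send e.proc)[p]?).map (fun m => .receive f.proc m)
    | none => none
  | .expire j p =>
    match R.event j with
    | some f => if f.proc = e.proc then ((out j).timers[p]?).map (fun x => .expire x.2) else none
    | none => none

/-- The states of all processes before event number `k`, and the outputs of the events with
smaller numbers (the other outputs are set to be empty). -/
noncomputable def Run.config (A : UniformAlgorithm.{v, w} V) (R : Run V n) :
    ℕ → (Fin n → A.State) × (ℕ → Output V A.Msg A.Timer)
  | 0 => (fun i => A.init i, fun _ => Output.empty)
  | k + 1 =>
    let c := Run.config A R k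
    match R.event k with
    | none => c
    | some e =>
      match R.input c.2 e with
      | none => c
      | some inp =>
        let r := A.step e.proc (c.1 e.proc) (e.time + R.offset e.proc) inp
        (Function.update c.1 e.proc r.1, Function.update c.2 k r.2)

/-- The output of event number `k`. -/
noncomputable def Run.output (A : UniformAlgorithm.{v, w} V) (R : Run V n) (k : ℕ) :
    Output V A.Msg A.Timer :=
  (R.config A (k + 1)).2 k

/-- Event number `k` exists and is the invocation of `op` at process `i`. -/
def Run.InvokesAt (R : Run V n) (k : ℕ) (i : Fin n) (op : Op V) : Prop :=
  ∃ e, R.event k = some e ∧ e.proc = i ∧ e.trigger = .invoke op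

/-- Event number `k` is the arrival at process `q` of the `p`-th message sent to it by event `j`. -/
def Run.DeliversAt (R : Run V n) (k : ℕ) (q : Fin n) (j p : ℕ) : Prop :=
  ∃ e, R.event k = some e ∧ e.proc = q ∧ e.trigger = .deliver j p

/-- Event number `k` is the expiration of the `p`-th timer set by event `j`. -/
def Run.ExpiresAt (R : Run V n) (k j p : ℕ) : Prop :=
  ∃ e, R.event k = some e ∧ e.trigger = .expire j p

/-- Event number `k` is a step of process `i` that generates the response `r`. -/
def Run.RespondsAt (A : UniformAlgorithm.{v, w} V) (R : Run V n) (k : ℕ) (i : Fin n)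
    (r : Response V) : Prop :=
  ∃ e, R.event k = some e ∧ e.proc = i ∧ (R.output A k).response = some r

/-- `R` is a possibly partial execution of `A` with message delays in `[d - u, d]` and skew at
most `(1 - 1/n) u`: it may stop before all messages are received and all timers have expired, but
no event takes place after the latest time at which a message or a timer is due. -/
structure Run.IsExecution (A : UniformAlgorithm.{v, w} V) (d u : ℝ) (R : Run V n) : Prop where
  skew : ∀ i j, R.offset i - R.offset j ≤ (1 - 1 / (n : ℝ)) * u
  /-- the sequence is ordered by real time -/
  time_mono : ∀ j k e f, j ≤ k → R.event j = some e → R.event k = some f → e.time ≤ f.time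
  /-- only messages that were sent earlier arrive, only timers that were set earlier expire -/
  input_valid : ∀ k e, R.event k = some e → (R.input (R.config A k).2 e).isSome
  deliver_once : ∀ k l q j p, R.DeliversAt k q j p → R.DeliversAt l q j p → k = l
  deliver_time : ∀ k q j p e f, R.DeliversAt k q j p → R.event k = some e → R.event j = some f →
    f.time + (d - u) ≤ e.time ∧ e.time ≤ f.time + d
  expire_once : ∀ k l j p, R.ExpiresAt k j p → R.ExpiresAt l j p → k = l
  expire_time : ∀ k j p e f x, R.ExpiresAt k j p → R.event k = some e → R.event j = some f →
    (R.output A j).timers[p]? = some x → e.time = f.time + x.1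
  deliver_due : ∀ j k q p e f, j < k → R.event j = some f → R.event k = some e →
    p < ((R.output A j).send (q : Fin n)).length →
    (∃ l, l < k ∧ R.DeliversAt l q j p) ∨ e.time ≤ f.time + d
  expire_due : ∀ j k p e f x, j < k → R.event j = some f → R.event k = some e →
    (R.output A j).timers[p]? = some x →
    (∃ l, l < k ∧ R.ExpiresAt l j p) ∨ e.time ≤ f.time + x.1
  /-- users invoke an operation at a process only when no operation is pending there -/
  invoke_not_pending : ∀ j k i op op', j < k → R.InvokesAt j i op → R.InvokesAt k i op' →
    ∃ m r, j ≤ m ∧ m < k ∧ R.RespondsAt A m i r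
  /-- all arguments of `Enqueue` are different -/
  enqueue_unique : ∀ j k i i' x, R.InvokesAt j i (.enqueue x) → R.InvokesAt k i' (.enqueue x) →
    j = k

/-- Admissible runs of `A`: every message is received (with a delay in `[d - u, d]`), every timer
expires, the skew is at most `(1 - 1/n) u`, and there are finitely many events up to any time. -/
structure Run.IsAdmissible (A : UniformAlgorithm.{v, w} V) (d u : ℝ) (R : Run V n) : Prop where
  execution : R.IsExecution A d u
  deliver_all : ∀ j (q : Fin n) p, p < ((R.output A j).send q).length → ∃ k, R.DeliversAt k q j p
  expire_all : ∀ j p, p < (R.output A j).timers.length → ∃ k, R.ExpiresAt k j p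
  locally_finite : ∀ t : ℝ, {k | ∃ e, R.event k = some e ∧ e.time ≤ t}.Finite

/-- The invocation of `op` in event number `k` is matched by the response `r` in event number `m`:
the first response at the same process from `k` on (possibly in the same step). -/
def Run.Matches (A : UniformAlgorithm.{v, w} V) (R : Run V n) (k m : ℕ) (op : Op V)
    (r : Response V) : Prop :=
  ∃ i, R.InvokesAt k i op ∧ k ≤ m ∧ R.RespondsAt A m i r ∧
    ∀ l r', k ≤ l → l < m → ¬ R.RespondsAt A l i r'

/-- The numbers of the events that are invocations; they stand for the operation instances. -/
def Run.Invocations (R : Run V n) : Set ℕ := {k | ∃ i op, R.InvokesAt k i op}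

/-- Real-time order: the instance invoked by event `a` returns before event `b` takes place, in
real time or, at the same process, in the order of its steps. -/
def Run.Precedes (A : UniformAlgorithm.{v, w} V) (R : Run V n) (a b : ℕ) : Prop :=
  ∃ m op r e f, R.Matches A a m op r ∧ R.event m = some e ∧ R.event b = some f ∧
    (e.time < f.time ∨ (e.proc = f.proc ∧ m < b))

/-- The operation instances of the run can be placed in a sequence of sets that is legal for the
multiplicity queue and respects the real-time order of non-overlapping instances. -/
def Run.IsSetLinearizable (A : UniformAlgorithm.{v, w} V) (R : Run V n) : Prop :=
  ∃ (inst : R.Invocations → OpInstance V) (pos : R.Invocations → ℕ),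
    (∀ a : R.Invocations, ∃ m op r, R.Matches A a m op r ∧ OpInstance.ofPair op r = some (inst a)) ∧
    (∀ a b : R.Invocations, R.Precedes A a b → pos a < pos b) ∧
    IsLegal inst pos

/-! ### Implementations and their cost -/

/-- `A` is a (live, eventually quiescent) set-linearizable implementation of a multiplicity queue,
in systems of every size `n ≥ 1` with maximum message delay `d` and delay uncertainty `u`. -/
structure UniformAlgorithm.IsSetLinearizableImplementation (A : UniformAlgorithm.{v, w} V)
    (d u : ℝ) : Prop where
  /-- every invocation has a matching response -/
  live : ∀ (n : ℕ) (R : Run V n), 1 ≤ n → R.IsAdmissible A d u →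
    ∀ k i op, R.InvokesAt k i op → ∃ m r, R.Matches A k m op r
  set_linearizable : ∀ (n : ℕ) (R : Run V n), 1 ≤ n → R.IsAdmissible A d u →
    R.IsSetLinearizable A
  /-- After finitely many invocations, only finitely many steps follow (also when infinitely many
  steps would fit into a finite time). When all of them are done, no message is in transit and
  no timer is set. -/
  quiescent : ∀ (n : ℕ) (R : Run V n), 1 ≤ n → R.IsExecution A d u →
    R.Invocations.Finite → {k | (R.event k).isSome}.Finite

/-- `|Dequeue|`: the worst case, over all admissible runs in systems of every size `n ≥ 1`, of the
real time between the invocation and the response of a `Dequeue` instance. -/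
noncomputable def UniformAlgorithm.dequeueTime (A : UniformAlgorithm.{v, w} V) (d u : ℝ) : ℝ≥0∞ :=
  sSup {x | ∃ (n : ℕ) (R : Run V n) (k m : ℕ) (r : Response V) (e f : Event V n),
    1 ≤ n ∧ R.IsAdmissible A d u ∧ R.Matches A k m .dequeue r ∧
    R.event k = some e ∧ R.event m = some f ∧ x = ENNReal.ofReal (f.time - e.time)}

end MultiplicityQueue

/-!
Suppose that every `Dequeue` returns in time less than `c < (d + u) / 2`. Choose a shift `σ < u`
(or `σ = u = 0`) with `2 * c ≤ d + σ`. In large systems clocks may differ by `σ`, since uniform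
algorithms have to cope with skews arbitrarily close to `u`.

All runs are described by local clocks (`Scenario`): some processes first invoke `Enqueue`, one
after the other, and processes `0, 1, 2, …` then invoke `Dequeue` at local times that are `c - σ`
apart. Messages to processes with a larger index take `d - σ`, the others take `d`. There are two
ways to realize such a scenario in real time. With synchronous clocks all delays are admissible.
If instead the clocks of all processes from `p` on are `σ` behind, then messages across the cut at
`p` change their delays from `d - σ` to `d` and conversely; so the run is still admissible, but
now `Dequeue` at process `p` is invoked after the previous ones have returned. As no process can
tell the difference, the last `Dequeue` always returns the first value that none of the previous
ones returns (`Schedule.Good.exists_last_returns`).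

By induction on `k` there are two scenarios with invocations at processes up to `k` in which the
processes before `k` return the same values, process `k` returns the first remaining value `v` in
one but not in the other, and only process `k` can know, from time `k * (d - σ)` on, which of the
two it is in (`Schedule.Stage`). For `k = 0`, these are the scenarios with and without a `Dequeue`
at process `0`. In a stage, a `Dequeue` at process `k + 1` cannot return `v` in the first scenario,
and must return `v` in the second; so it returns different values (`Schedule.Stage.exists_values`).
If the late messages from `k` to `k + 1` take `d` instead of `d - σ`, then process `k + 1` has to
respond before it can distinguish the two scenarios, because `2 * c ≤ d + σ`; so it returns the
same value `y` in both. Hence in at least one of them this change of delays changes the value at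
process `k + 1`, and that scenario with and without the change is a pair for `k + 1`
(`Schedule.Stage.succ`). On the other hand, process `k + 1` cannot distinguish the two
unchanged scenarios before time `(k + 1) * (d - σ)`. This is too late if
`(k + 2) * c ≤ (k + 1) * d` (`Schedule.Stage.false`), which holds for large `k` because `c < d`.

To have these runs, scenarios are simulated in the order of real time (`Scenario.run`). The
simulation ends, as the algorithm is quiescent. Its local histories are characterized without
reference to real time (`IsHistory`), and complete histories of two scenarios agree wherever the
difference between the scenarios has not arrived yet (`Indist.getElem?_iff`). This covers both
shifts and changes of delays and invocations.
-/

namespace MultiplicityQueue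

universe v w

/-! ### Local histories -/

/-- A step of a process as the process itself sees it: the local clock value, the input, and a
`code` which orders the inputs that arrive at the same local time. The code is `[0]` for an
invocation, `[i + 1, m, p]` for the `p`-th message sent to this process by step number `m` of
process `i`, and `[n + 1, m, p]` for the `p`-th timer set by step number `m` of this process. -/
structure Entry (V : Type v) (Msg Timer : Type w) : Type (max v w) where
  time : ℝ
  code : List ℕ
  inp : Input V Msg Timer

variable {V : Type v} {n : ℕ}

/-- The order in which a process takes its steps. -/
def Entry.key {Msg Timer : Type w} (e : Entry V Msg Timer) : ℝ ×ₗ List ℕ := toLex (e.time, e.code)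

lemma Entry.time_le_of_key_le {Msg Timer : Type w} {e f : Entry V Msg Timer}
    (h : e.key ≤ f.key) : e.time ≤ f.time := by
  have := (Prod.Lex.le_iff).1 h
  rcases this with h | h
  · exact h.le
  · exact h.1.le

/-- The state of process `i` after the steps in `l`. -/
def stateAfter (A : UniformAlgorithm.{v, w} V) (i : ℕ) (l : List (Entry V A.Msg A.Timer)) :
    A.State :=
  l.foldl (fun s e => (A.step i s e.time e.inp).1) (A.init i)

/-- The output of step `e` of process `i` if `l` lists its earlier steps. -/
def outputAfter (A : UniformAlgorithm.{v, w} V) (i : ℕ) (l : List (Entry V A.Msg A.Timer))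
    (e : Entry V A.Msg A.Timer) : Output V A.Msg A.Timer :=
  (A.step i (stateAfter A i l) e.time e.inp).2

/-- What the environment of `n` processes contributes to a run in terms of local clocks: the
invocation at each process, at most one, with its local time; and `delay i j t`, the local time
of arrival at `j` minus the local time `t` of sending for messages from `i` to `j`. -/
structure Scenario (V : Type v) (n : ℕ) : Type v where
  invoke : Fin n → Option (ℝ × Op V)
  delay : Fin n → Fin n → ℝ → ℝ

/-- The steps that process `i` has to take in scenario `S` if the steps of all processes are
listed in `L`. -/
inductive Generated (A : UniformAlgorithm.{v, w} V) (S : Scenario V n)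
    (L : Fin n → List (Entry V A.Msg A.Timer)) (i : Fin n) : Entry V A.Msg A.Timer → Prop
  | invoke (t : ℝ) (op : Op V) (h : S.invoke i = some (t, op)) :
      Generated A S L i ⟨t, [0], .invoke op⟩
  | receive (j : Fin n) (m : ℕ) (f : Entry V A.Msg A.Timer) (p : ℕ) (msg : A.Msg)
      (hf : (L j)[m]? = some f)
      (hp : ((outputAfter A j ((L j).take m) f).send i)[p]? = some msg) :
      Generated A S L i ⟨f.time + S.delay j i f.time, [j + 1, m, p], .receive j msg⟩
  | expire (m : ℕ) (f : Entry V A.Msg A.Timer) (p : ℕ) (x : ℝ≥0 × A.Timer)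
      (hf : (L i)[m]? = some f)
      (hp : (outputAfter A i ((L i).take m) f).timers[p]? = some x) :
      Generated A S L i ⟨f.time + x.1, [n + 1, m, p], .expire x.2⟩

/-- `L` lists, for each process, the steps it takes in a complete run of `A` in scenario `S`. Real
time does not occur here. By `causal`, a timer of duration zero expires after the step that sets
it. -/
structure IsHistory (A : UniformAlgorithm.{v, w} V) (S : Scenario V n)
    (L : Fin n → List (Entry V A.Msg A.Timer)) : Prop where
  sorted : ∀ i, (L i).Pairwise (fun e f => e.key < f.key)
  mem_iff : ∀ i e, e ∈ L i ↔ Generated A S L i e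
  causal : ∀ i m m' p e, (L i)[m]? = some e → e.code = [n + 1, m', p] → m' < m

section Sorted

variable {Msg Timer : Type w} {l l' : List (Entry V Msg Timer)}

lemma key_lt_of_sorted (h : l.Pairwise (fun e f => e.key < f.key)) {a b : ℕ}
    {e f : Entry V Msg Timer}
    (ha : l[a]? = some e) (hb : l[b]? = some f) (hab : a < b) : e.key < f.key := by
  obtain ⟨ha', rfl⟩ := List.getElem?_eq_some_iff.1 ha
  obtain ⟨hb', rfl⟩ := List.getElem?_eq_some_iff.1 hb
  exact List.pairwise_iff_getElem.1 h a b ha' hb' hab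

lemma key_le_of_sorted (h : l.Pairwise (fun e f => e.key < f.key)) {a b : ℕ}
    {e f : Entry V Msg Timer}
    (ha : l[a]? = some e) (hb : l[b]? = some f) (hab : a ≤ b) : e.key ≤ f.key := by
  rcases hab.eq_or_lt with rfl | hab
  · rw [ha] at hb; cases hb; exact le_rfl
  · exact (key_lt_of_sorted h ha hb hab).le

lemma getElem?_isSome_of_le {a b : ℕ} {e : Entry V Msg Timer} (hb : l[b]? = some e) (hab : a ≤ b) :
    ∃ f, l[a]? = some f := by
  obtain ⟨hb', -⟩ := List.getElem?_eq_some_iff.1 hb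
  exact ⟨l[a], List.getElem?_eq_getElem (by omega)⟩

lemma take_eq_of_agree (h : l.Pairwise (fun e f => e.key < f.key)) {B : ℝ} {m : ℕ}
    (ih : ∀ a < m, ∀ e, e.time < B → l[a]? = some e → l'[a]? = some e)
    {x : Entry V Msg Timer} (hx : l[m]? = some x) (hxB : x.time < B) :
    l.take m = l'.take m := by
  apply List.ext_getElem?
  intro a
  rw [List.getElem?_take, List.getElem?_take]
  split_ifs with ham
  · obtain ⟨f, hf⟩ := getElem?_isSome_of_le hx ham.le
    have := Entry.time_le_of_key_le (key_lt_of_sorted h hf hx ham).le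
    rw [hf, ih a ham f (by linarith) hf]
  · rfl

/-- Two sorted lists that agree before position `m`, and each of which contains the entry of the
other at position `m`, agree there. -/
lemma getElem?_eq_of_agree (h : l.Pairwise (fun e f => e.key < f.key))
    (h' : l'.Pairwise (fun e f => e.key < f.key)) {B : ℝ} {m : ℕ}
    (ih : ∀ a < m, ∀ e, e.time < B → (l[a]? = some e ↔ l'[a]? = some e))
    (hl : ∀ e, e.time < B → l[m]? = some e → e ∈ l')
    (hl' : ∀ e, e.time < B → l'[m]? = some e → e ∈ l)
    {x : Entry V Msg Timer} (hx : l[m]? = some x) (hxB : x.time < B) : l'[m]? = some x := by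
  obtain ⟨a, ha⟩ := List.mem_iff_getElem?.1 (hl x hxB hx)
  have ham : m ≤ a := by
    by_contra hcon
    push Not at hcon
    exact lt_irrefl _ (key_lt_of_sorted h ((ih a hcon x hxB).2 ha) hx hcon)
  obtain ⟨y, hy⟩ := getElem?_isSome_of_le ha ham
  have hyx := key_le_of_sorted h' hy ha ham
  have hyB : y.time < B := (Entry.time_le_of_key_le hyx).trans_lt hxB
  obtain ⟨b, hb⟩ := List.mem_iff_getElem?.1 (hl' y hyB hy)
  have hbm : m ≤ b := by
    by_contra hcon
    push Not at hcon
    exact lt_irrefl _ (key_lt_of_sorted h' ((ih b hcon y hyB).1 hb) hy hcon)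
  have hxy := key_le_of_sorted h hx hb hbm
  rcases ham.eq_or_lt with rfl | hlt
  · exact ha
  · exact absurd (key_lt_of_sorted h' hy ha hlt) (not_lt.2 hxy)

end Sorted

/-! ### Indistinguishability -/

section Agree

variable {A : UniformAlgorithm.{v, w} V} {S S' : Scenario V n}
  {L L' : Fin n → List (Entry V A.Msg A.Timer)}

/-- No difference between `S` and `S'` that is caused before the local times `β` reaches any
process before its time in `β`. -/
structure Indist (S S' : Scenario V n) (β : Fin n → ℝ) : Prop where
  invoke : ∀ i t op, t < β i → S.invoke i = some (t, op) → S'.invoke i = some (t, op)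
  delay : ∀ j i t, t + S.delay j i t < β i → t < β j ∧ S'.delay j i t = S.delay j i t

/-- The step taken at position `m` in one history is also taken in the other, if the histories agree
before time `θ` and, at this process, before position `m`: messages were sent before time `θ`, and
timers were set at earlier positions. -/
lemma mem_of_agree (hL : IsHistory A S L) (hL' : IsHistory A S' L') {β : Fin n → ℝ} {δ θ : ℝ}
    (hS : Indist S S' β) (hδ : ∀ i j t, δ ≤ S.delay i j t)
    (hθ : ∀ i (m : ℕ) (e : Entry V A.Msg A.Timer), e.time < β i → e.time < θ →
      (L i)[m]? = some e → (L' i)[m]? = some e)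
    {i : Fin n} {m : ℕ}
    (ih : ∀ a < m, ∀ e, e.time < min (β i) (θ + δ) → (L i)[a]? = some e → (L' i)[a]? = some e)
    {x : Entry V A.Msg A.Timer} (hxB : x.time < min (β i) (θ + δ)) (hx : (L i)[m]? = some x) :
    x ∈ L' i := by
  rw [lt_min_iff] at hxB
  have hg := (hL.mem_iff i x).1 (List.mem_of_getElem? hx)
  rw [hL'.mem_iff]
  cases hg with
  | invoke t op h => exact .invoke t op (hS.invoke i t op hxB.1 h)
  | receive j a f p msg hf hp =>
    obtain ⟨h1, h2⟩ := hS.delay j i f.time hxB.1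
    have h3 : f.time < θ := by
      have := hδ j i f.time
      have := hxB.2
      simp only at this
      linarith
    have hf' := hθ j a f h1 h3 hf
    have htake : (L j).take a = (L' j).take a :=
      take_eq_of_agree (hL.sorted j) (B := min (β j) θ)
        (fun b _ e he hb => hθ j b e (he.trans_le (min_le_left _ _))
          (he.trans_le (min_le_right _ _)) hb)
        hf (lt_min h1 h3)
    rw [htake] at hp
    rw [← h2]
    exact .receive j a f p msg hf' hp
  | expire a f p y hf hp =>
    have ham : a < m := hL.causal i m a p _ hx rfl
    have h1 : f.time < min (β i) (θ + δ) := by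
      have h2 := Entry.time_le_of_key_le (key_lt_of_sorted (hL.sorted i) hf hx ham).le
      exact h2.trans_lt (lt_min hxB.1 hxB.2)
    have htake : (L i).take a = (L' i).take a :=
      take_eq_of_agree (hL.sorted i) (fun b hb e he hbe => ih b (hb.trans ham) e he hbe) hf h1
    rw [htake] at hp
    exact .expire a f p y (ih a ham f h1 hf) hp

/-- Complete runs in indistinguishable scenarios look the same to each process before its time in
`β`. As all delays are at least `δ > 0`, this follows by induction over time slices of length
`δ`, and by induction over the steps of the process within a slice. -/
theorem Indist.getElem?_iff (hL : IsHistory A S L) (hL' : IsHistory A S' L') {β : Fin n → ℝ}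
    (hS : Indist S S' β) (hS' : Indist S' S β) {δ : ℝ} (hδ0 : 0 < δ)
    (hδ : ∀ i j t, δ ≤ S.delay i j t) (hδ' : ∀ i j t, δ ≤ S'.delay i j t)
    (i : Fin n) (m : ℕ) (e : Entry V A.Msg A.Timer) (he : e.time < β i) :
    (L i)[m]? = some e ↔ (L' i)[m]? = some e := by
  have hfin : {t | ∃ i, ∃ e, (e ∈ L i ∨ e ∈ L' i) ∧ e.time = t}.Finite := by
    have : {t | ∃ i, ∃ e, (e ∈ L i ∨ e ∈ L' i) ∧ e.time = t} =
        ⋃ i, Entry.time '' {e | e ∈ L i ++ L' i} := by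
      ext t; simp
    rw [this]
    exact Set.finite_iUnion fun i => (List.finite_toSet _).image _
  obtain ⟨t₀, ht₀⟩ := hfin.bddBelow
  have key : ∀ N : ℕ, ∀ i (m : ℕ) (e : Entry V A.Msg A.Timer), e.time < β i → e.time < t₀ + N * δ →
      ((L i)[m]? = some e ↔ (L' i)[m]? = some e) := by
    intro N
    induction N with
    | zero =>
      intro i m e _ h2
      simp only [Nat.cast_zero, zero_mul, add_zero] at h2
      constructor <;> intro h
      · exact absurd (ht₀ ⟨i, e, Or.inl (List.mem_of_getElem? h), rfl⟩) (not_le.2 h2)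
      · exact absurd (ht₀ ⟨i, e, Or.inr (List.mem_of_getElem? h), rfl⟩) (not_le.2 h2)
    | succ N ihN =>
      intro i m
      induction m using Nat.strong_induction_on with
      | _ m ih =>
        have hN : t₀ + ((N + 1 : ℕ) : ℝ) * δ = t₀ + N * δ + δ := by push_cast; ring
        rw [hN] at ih ⊢
        intro e he1 he2
        have ih' : ∀ a < m, ∀ e, e.time < min (β i) (t₀ + N * δ + δ) →
            ((L i)[a]? = some e ↔ (L' i)[a]? = some e) := fun a ha e he =>
          ih a ha e (he.trans_le (min_le_left _ _)) (he.trans_le (min_le_right _ _))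
        have h1 : ∀ e, e.time < min (β i) (t₀ + N * δ + δ) → (L i)[m]? = some e → e ∈ L' i :=
          fun e he h => mem_of_agree hL hL' hS hδ (fun i m e h1 h2 => (ihN i m e h1 h2).1)
            (fun a ha e he => (ih' a ha e he).1) he h
        have h2 : ∀ e, e.time < min (β i) (t₀ + N * δ + δ) → (L' i)[m]? = some e → e ∈ L i :=
          fun e he h => mem_of_agree hL' hL hS' hδ' (fun i m e h1 h2 => (ihN i m e h1 h2).2)
            (fun a ha e he => (ih' a ha e he).2) he h
        exact ⟨fun h => getElem?_eq_of_agree (hL.sorted i) (hL'.sorted i) ih' h1 h2 h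
            (lt_min he1 he2),
          fun h => getElem?_eq_of_agree (hL'.sorted i) (hL.sorted i)
            (fun a ha e he => (ih' a ha e he).symm) h2 h1 h (lt_min he1 he2)⟩
  obtain ⟨N, hN⟩ := exists_nat_gt ((e.time - t₀) / δ)
  rw [div_lt_iff₀ hδ0] at hN
  exact key N i m e he (by linarith)

end Agree

/-! ### Simulation of a scenario -/

/-- A step that is due: process `dst` has to take the step `entry`; in a run, the event is
triggered by `trig`. -/
structure Item (V : Type v) (n : ℕ) (Msg Timer : Type w) : Type (max v w) where
  dst : Fin n
  entry : Entry V Msg Timer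
  trig : Trigger V

/-- The real time of an item if the clock of process `i` is `s i` behind. -/
def Item.realTime {Msg Timer : Type w} (s : Fin n → ℝ) (x : Item V n Msg Timer) : ℝ :=
  x.entry.time + s x.dst

/-- Items are executed in the order of real time, items at the same time in the order of processes
and, at the same process, in the order of codes. -/
def Item.key {Msg Timer : Type w} (s : Fin n → ℝ) (x : Item V n Msg Timer) :
    ℝ ×ₗ Fin n ×ₗ List ℕ :=
  toLex (x.realTime s, toLex (x.dst, x.entry.code))

lemma Item.realTime_le_of_key_le {Msg Timer : Type w} {s : Fin n → ℝ} {x y : Item V n Msg Timer}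
    (h : x.key s ≤ y.key s) : x.realTime s ≤ y.realTime s := by
  rcases (Prod.Lex.le_iff).1 h with h | h
  · exact h.le
  · exact h.1.le

lemma Item.entry_key_le_of_key_le {Msg Timer : Type w} {s : Fin n → ℝ} {x y : Item V n Msg Timer}
    (h : x.key s ≤ y.key s) (hd : x.dst = y.dst) : x.entry.key ≤ y.entry.key := by
  refine (Prod.Lex.le_iff).2 ?_
  rcases (Prod.Lex.le_iff).1 h with h | ⟨h1, h2⟩
  · left
    have h' : x.entry.time + s x.dst < y.entry.time + s y.dst := h
    rw [hd] at h'
    exact lt_of_add_lt_add_right h'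
  · right
    have h' : x.entry.time + s x.dst = y.entry.time + s y.dst := h1
    rw [hd] at h'
    refine ⟨add_right_cancel h', ?_⟩
    rcases (Prod.Lex.le_iff).1 h2 with h2 | ⟨h2, h3⟩
    · exact absurd hd h2.ne
    · exact h3

/-- The steps already taken by each process, and the items that are due. -/
structure SimState (V : Type v) (n : ℕ) (Msg Timer : Type w) : Type (max v w) where
  log : Fin n → List (Entry V Msg Timer)
  pend : Set (Item V n Msg Timer)

/-- The items for the invocations. -/
def Scenario.initItems (S : Scenario V n) (Msg Timer : Type w) : Set (Item V n Msg Timer) :=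
  {y | ∃ t op, S.invoke y.dst = some (t, op) ∧ y = ⟨y.dst, ⟨t, [0], .invoke op⟩, .invoke op⟩}

/-- The items created when `x` is executed as event number `k`, after the steps in `log`. -/
def Scenario.newItems (S : Scenario V n) (A : UniformAlgorithm.{v, w} V) (k : ℕ)
    (log : Fin n → List (Entry V A.Msg A.Timer)) (x : Item V n A.Msg A.Timer) :
    Set (Item V n A.Msg A.Timer) :=
  {y | ∃ q p msg, ((outputAfter A x.dst (log x.dst) x.entry).send (q : Fin n))[p]? = some msg ∧
      y = ⟨q, ⟨x.entry.time + S.delay x.dst q x.entry.time, [x.dst + 1, (log x.dst).length, p],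
        .receive x.dst msg⟩, .deliver k p⟩} ∪
  {y | ∃ p z, (outputAfter A x.dst (log x.dst) x.entry).timers[p]? = some z ∧
      y = ⟨x.dst, ⟨x.entry.time + z.1, [n + 1, (log x.dst).length, p], .expire z.2⟩, .expire k p⟩}

open Classical in
/-- The first of the items that are due. -/
noncomputable def firstItem {Msg Timer : Type w} (s : Fin n → ℝ) (P : Set (Item V n Msg Timer)) :
    Option (Item V n Msg Timer) :=
  if h : ∃ x ∈ P, ∀ y ∈ P, x.key s ≤ y.key s then some h.choose else none

lemma firstItem_spec {Msg Timer : Type w} {s : Fin n → ℝ} {P : Set (Item V n Msg Timer)}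
    {x : Item V n Msg Timer} (h : firstItem s P = some x) :
    x ∈ P ∧ ∀ y ∈ P, x.key s ≤ y.key s := by
  unfold firstItem at h
  split_ifs at h with h'
  cases h
  exact h'.choose_spec

lemma eq_empty_of_firstItem {Msg Timer : Type w} {s : Fin n → ℝ} {P : Set (Item V n Msg Timer)}
    (hP : P.Finite) (h : firstItem s P = none) : P = ∅ := by
  unfold firstItem at h
  split_ifs at h with h'
  by_contra hne
  exact h' (Set.exists_min_image P (Item.key s) hP (Set.nonempty_iff_ne_empty.2 hne))

/-- The states of the simulation of `A` in the scenario `S` with clocks that are `s` behind. -/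
noncomputable def Scenario.sim (S : Scenario V n) (A : UniformAlgorithm.{v, w} V) (s : Fin n → ℝ) :
    ℕ → SimState V n A.Msg A.Timer
  | 0 => ⟨fun _ => [], S.initItems A.Msg A.Timer⟩
  | k + 1 =>
    let c := Scenario.sim S A s k
    match firstItem s c.pend with
    | none => c
    | some x => ⟨Function.update c.log x.dst (c.log x.dst ++ [x.entry]),
        (c.pend \ {x}) ∪ S.newItems A k c.log x⟩

/-- The item executed as event number `k`. -/
noncomputable def Scenario.pick (S : Scenario V n) (A : UniformAlgorithm.{v, w} V) (s : Fin n → ℝ)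
    (k : ℕ) : Option (Item V n A.Msg A.Timer) :=
  firstItem s (S.sim A s k).pend

/-- The run that results from the simulation. -/
noncomputable def Scenario.run (S : Scenario V n) (A : UniformAlgorithm.{v, w} V) (s : Fin n → ℝ) :
    Run V n where
  offset i := - s i
  event k := (S.pick A s k).map fun x => ⟨x.dst, x.realTime s, x.trig⟩

section Simulation

variable {S : Scenario V n} {A : UniformAlgorithm.{v, w} V} {s : Fin n → ℝ}

lemma sim_succ_of_none {k : ℕ} (h : S.pick A s k = none) : S.sim A s (k + 1) = S.sim A s k := by
  unfold Scenario.pick at h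
  rw [Scenario.sim]
  simp only [h]

lemma sim_succ_of_some {k : ℕ} {x : Item V n A.Msg A.Timer} (h : S.pick A s k = some x) :
    S.sim A s (k + 1) = ⟨Function.update (S.sim A s k).log x.dst
      ((S.sim A s k).log x.dst ++ [x.entry]),
      ((S.sim A s k).pend \ {x}) ∪ S.newItems A k (S.sim A s k).log x⟩ := by
  unfold Scenario.pick at h
  rw [Scenario.sim]
  simp only [h]

lemma event_eq_some_iff {k : ℕ} {e : Event V n} :
    (S.run A s).event k = some e ↔
      ∃ x, S.pick A s k = some x ∧ e = ⟨x.dst, x.realTime s, x.trig⟩ := by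
  simp [Scenario.run, eq_comm]

/-- The items that have been created before event number `k`. -/
def Born (S : Scenario V n) (A : UniformAlgorithm.{v, w} V) (s : Fin n → ℝ) (k : ℕ)
    (y : Item V n A.Msg A.Timer) : Prop :=
  y ∈ S.initItems A.Msg A.Timer ∨
    ∃ j < k, ∃ z, S.pick A s j = some z ∧ y ∈ S.newItems A j (S.sim A s j).log z

lemma trig_of_mem_newItems {k : ℕ} {log : Fin n → List (Entry V A.Msg A.Timer)}
    {x y : Item V n A.Msg A.Timer} (h : y ∈ S.newItems A k log x) :
    ∃ p, y.trig = .deliver k p ∨ y.trig = .expire k p := by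
  rcases h with ⟨q, p, msg, -, rfl⟩ | ⟨p, z, -, rfl⟩
  · exact ⟨p, Or.inl rfl⟩
  · exact ⟨p, Or.inr rfl⟩

lemma not_born_of_mem_newItems {k : ℕ} {log : Fin n → List (Entry V A.Msg A.Timer)}
    {x y : Item V n A.Msg A.Timer} (h : y ∈ S.newItems A k log x) : ¬ Born S A s k y := by
  obtain ⟨p, hp⟩ := trig_of_mem_newItems h
  rintro (⟨t, op, -, h2⟩ | ⟨j, hj, z, -, h2⟩)
  · rw [h2] at hp; simp at hp
  · obtain ⟨p', hp'⟩ := trig_of_mem_newItems h2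
    rcases hp with hp | hp <;> rw [hp] at hp' <;> simp at hp' <;> omega

lemma Born.mono {k l : ℕ} {y : Item V n A.Msg A.Timer} (h : Born S A s k y) (hkl : k ≤ l) :
    Born S A s l y :=
  h.imp id fun ⟨j, hj, h⟩ => ⟨j, hj.trans_le hkl, h⟩

lemma born_of_mem_pend {k : ℕ} {y : Item V n A.Msg A.Timer} (h : y ∈ (S.sim A s k).pend) :
    Born S A s k y := by
  induction k generalizing y with
  | zero => exact Or.inl h
  | succ k ih =>
    cases hp : S.pick A s k with
    | none =>
      rw [sim_succ_of_none hp] at h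
      exact (ih h).mono k.le_succ
    | some x =>
      rw [sim_succ_of_some hp] at h
      rcases h with h | h
      · exact (ih h.1).mono k.le_succ
      · exact Or.inr ⟨k, k.lt_succ_self, x, hp, h⟩

lemma born_of_pick {k : ℕ} {x : Item V n A.Msg A.Timer} (h : S.pick A s k = some x) :
    Born S A s k x :=
  born_of_mem_pend (firstItem_spec h).1

/-- The items that are due are those that have been created but not executed. -/
lemma mem_pend_iff {k : ℕ} {y : Item V n A.Msg A.Timer} :
    y ∈ (S.sim A s k).pend ↔ Born S A s k y ∧ ∀ l < k, S.pick A s l ≠ some y := by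
  refine ⟨fun h => ⟨born_of_mem_pend h, ?_⟩, ?_⟩
  · induction k generalizing y with
    | zero => simp
    | succ k ih =>
      intro l hl hly
      cases hp : S.pick A s k with
      | none =>
        rw [sim_succ_of_none hp] at h
        rcases Nat.lt_succ_iff_lt_or_eq.1 hl with hl | rfl
        · exact ih h l hl hly
        · rw [hp] at hly; cases hly
      | some x =>
        rw [sim_succ_of_some hp] at h
        rcases h with h | h
        · rcases Nat.lt_succ_iff_lt_or_eq.1 hl with hl | rfl
          · exact ih h.1 l hl hly
          · rw [hp] at hly; cases hly; exact h.2 rfl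
        · exact not_born_of_mem_newItems h ((born_of_pick hly).mono (Nat.lt_succ_iff.1 hl))
  · induction k generalizing y with
    | zero =>
      rintro ⟨h | ⟨j, hj, -⟩, -⟩
      · exact h
      · omega
    | succ k ih =>
      rintro ⟨h1, h2⟩
      have h3 := h2 k (by omega)
      have h4 : Born S A s k y ∨ ∃ z, S.pick A s k = some z ∧
          y ∈ S.newItems A k (S.sim A s k).log z := by
        rcases h1 with h1 | ⟨j, hj, h⟩
        · exact Or.inl (Or.inl h1)
        · rcases Nat.lt_succ_iff_lt_or_eq.1 hj with hj | rfl
          · exact Or.inl (Or.inr ⟨j, hj, h⟩)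
          · exact Or.inr h
      cases hp : S.pick A s k with
      | none =>
        rw [sim_succ_of_none hp]
        rcases h4 with h4 | ⟨z, hz, -⟩
        · exact ih ⟨h4, fun l hl => h2 l (by omega)⟩
        · rw [hp] at hz; cases hz
      | some x =>
        rw [sim_succ_of_some hp]
        rcases h4 with h4 | ⟨z, hz, h⟩
        · refine Or.inl ⟨ih ⟨h4, fun l hl => h2 l (by omega)⟩, ?_⟩
          rintro rfl; exact h3 hp
        · rw [hp] at hz; cases hz; exact Or.inr h

lemma pick_injective {k l : ℕ} {x : Item V n A.Msg A.Timer} (hk : S.pick A s k = some x)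
    (hl : S.pick A s l = some x) : k = l := by
  rcases lt_trichotomy k l with h | h | h
  · exact absurd hk ((mem_pend_iff.1 (firstItem_spec hl).1).2 k h)
  · exact h
  · exact absurd hl ((mem_pend_iff.1 (firstItem_spec hk).1).2 l h)

/-- An item triggered by the arrival of a message is created by the step that sends it. -/
lemma Born.of_deliver {k j p : ℕ} {y : Item V n A.Msg A.Timer} (h : Born S A s k y)
    (hy : y.trig = .deliver j p) : j < k ∧ ∃ z msg, S.pick A s j = some z ∧
      ((outputAfter A z.dst ((S.sim A s j).log z.dst) z.entry).send y.dst)[p]? = some msg ∧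
      y = ⟨y.dst, ⟨z.entry.time + S.delay z.dst y.dst z.entry.time,
        [z.dst + 1, ((S.sim A s j).log z.dst).length, p], .receive z.dst msg⟩, .deliver j p⟩ := by
  rcases h with ⟨t, op, -, h⟩ | ⟨j', hj', z, hz, ⟨q, p', msg, hm, h⟩ | ⟨p', x, hx, h⟩⟩
  · rw [h] at hy; simp at hy
  · rw [h] at hy
    simp only [Trigger.deliver.injEq] at hy
    obtain ⟨rfl, rfl⟩ := hy
    rw [h]
    exact ⟨hj', z, msg, hz, hm, rfl⟩
  · rw [h] at hy; simp at hy

/-- An item triggered by the expiration of a timer is created by the step that sets it. -/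
lemma Born.of_expire {k j p : ℕ} {y : Item V n A.Msg A.Timer} (h : Born S A s k y)
    (hy : y.trig = .expire j p) : j < k ∧ ∃ z x, S.pick A s j = some z ∧
      (outputAfter A z.dst ((S.sim A s j).log z.dst) z.entry).timers[p]? = some x ∧
      y = ⟨z.dst, ⟨z.entry.time + x.1,
        [n + 1, ((S.sim A s j).log z.dst).length, p], .expire x.2⟩, .expire j p⟩ := by
  rcases h with ⟨t, op, -, h⟩ | ⟨j', hj', z, hz, ⟨q, p', msg, hm, h⟩ | ⟨p', x, hx, h⟩⟩
  · rw [h] at hy; simp at hy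
  · rw [h] at hy; simp at hy
  · rw [h] at hy
    simp only [Trigger.expire.injEq] at hy
    obtain ⟨rfl, rfl⟩ := hy
    rw [h]
    exact ⟨hj', z, x, hz, hx, rfl⟩

lemma Born.of_invoke {k : ℕ} {op : Op V} {y : Item V n A.Msg A.Timer} (h : Born S A s k y)
    (hy : y.trig = .invoke op) : ∃ t, S.invoke y.dst = some (t, op) ∧
      y = ⟨y.dst, ⟨t, [0], .invoke op⟩, .invoke op⟩ := by
  rcases h with ⟨t, op', ht, h⟩ | ⟨j', hj', z, hz, h⟩
  · have : op' = op := by rw [h] at hy; simpa using hy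
    subst this
    exact ⟨t, ht, h⟩
  · obtain ⟨p, hp⟩ := trig_of_mem_newItems h
    rw [hy] at hp; simp at hp

/-! ### The simulation is an execution -/

/-- The output of event number `k`. -/
noncomputable def Scenario.simOut (S : Scenario V n) (A : UniformAlgorithm.{v, w} V)
    (s : Fin n → ℝ) (k : ℕ) : Output V A.Msg A.Timer :=
  match S.pick A s k with
  | none => Output.empty
  | some x => outputAfter A x.dst ((S.sim A s k).log x.dst) x.entry

lemma simOut_of_pick {k : ℕ} {x : Item V n A.Msg A.Timer} (h : S.pick A s k = some x) :
    S.simOut A s k = outputAfter A x.dst ((S.sim A s k).log x.dst) x.entry := by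
  rw [Scenario.simOut, h]

lemma event_of_pick {k : ℕ} {x : Item V n A.Msg A.Timer} (h : S.pick A s k = some x) :
    (S.run A s).event k = some ⟨x.dst, x.realTime s, x.trig⟩ :=
  event_eq_some_iff.2 ⟨x, h, rfl⟩

lemma event_of_pick_none {k : ℕ} (h : S.pick A s k = none) : (S.run A s).event k = none := by
  simp [Scenario.run, h]

/-- Items carry the input that the run computes from their triggers. -/
lemma input_of_born {k : ℕ} {x : Item V n A.Msg A.Timer} (h : Born S A s k x)
    {out : ℕ → Output V A.Msg A.Timer} (hout : ∀ j < k, out j = S.simOut A s j) :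
    (S.run A s).input out ⟨x.dst, x.realTime s, x.trig⟩ = some x.entry.inp := by
  cases ht : x.trig with
  | invoke op =>
    obtain ⟨t, -, hx⟩ := h.of_invoke ht
    rw [hx]
    rfl
  | deliver j p =>
    obtain ⟨hj, z, msg, hz, hm, hx⟩ := h.of_deliver ht
    simp only [Run.input, event_of_pick hz, hout j hj, simOut_of_pick hz, hm]
    rw [hx]
    rfl
  | expire j p =>
    obtain ⟨hj, z, y, hz, hm, hx⟩ := h.of_expire ht
    have hd : z.dst = x.dst := by rw [hx]
    simp only [Run.input, event_of_pick hz, hout j hj, simOut_of_pick hz, hm, if_pos hd]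
    rw [hx]
    rfl

lemma config_run (k : ℕ) : (S.run A s).config A k =
    (fun i : Fin n => stateAfter A i ((S.sim A s k).log i),
      fun j => if j < k then S.simOut A s j else Output.empty) := by
  induction k with
  | zero => simp [Run.config, Scenario.sim, stateAfter]
  | succ k ih =>
    rw [Run.config]
    simp only [ih]
    cases hp : S.pick A s k with
    | none =>
      simp only [event_of_pick_none hp, sim_succ_of_none hp, Prod.mk.injEq, true_and]
      funext j
      rcases lt_trichotomy j k with h | rfl | h
      · rw [if_pos h, if_pos (by omega)]
      · simp [Scenario.simOut, hp]
      · rw [if_neg (by omega), if_neg (by omega)]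
    | some x =>
      simp only [event_of_pick hp, sim_succ_of_some hp]
      rw [input_of_born (born_of_pick hp) (fun j hj => if_pos hj)]
      have ht : x.realTime s + (S.run A s).offset x.dst = x.entry.time := by
        simp [Scenario.run, Item.realTime]
      simp only [ht, Prod.mk.injEq]
      constructor
      · funext i
        by_cases hi : i = x.dst
        · subst hi
          simp [stateAfter]
        · simp [Function.update_of_ne hi]
      · funext j
        rcases lt_trichotomy j k with h | rfl | h
        · rw [Function.update_of_ne (by omega), if_pos h, if_pos (by omega)]
        · simp [simOut_of_pick hp, outputAfter]
        · rw [Function.update_of_ne (by omega), if_neg (by omega), if_neg (by omega)]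

lemma output_run (k : ℕ) : (S.run A s).output A k = S.simOut A s k := by
  rw [Run.output, config_run]
  simp

/-- The conditions under which a scenario with clocks that are `s` behind gives an execution; the
real-time delay of a message from `i` to `j` is its local delay plus `s j - s i`. -/
structure Scenario.Valid (S : Scenario V n) (s : Fin n → ℝ) (d u : ℝ) : Prop where
  skew : ∀ i j, s i - s j ≤ (1 - 1 / (n : ℝ)) * u
  delay_pos : ∀ i j t, 0 < S.delay i j t + s j - s i
  le_delay : ∀ i j t, d - u ≤ S.delay i j t + s j - s i
  delay_le : ∀ i j t, S.delay i j t + s j - s i ≤ d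
  enqueue_unique : ∀ i j t t' x, S.invoke i = some (t, .enqueue x) →
    S.invoke j = some (t', .enqueue x) → i = j

lemma realTime_le_of_mem_newItems {d u : ℝ} (hS : S.Valid s d u) {k : ℕ}
    {log : Fin n → List (Entry V A.Msg A.Timer)}
    {x y : Item V n A.Msg A.Timer} (h : y ∈ S.newItems A k log x) :
    x.realTime s ≤ y.realTime s := by
  rcases h with ⟨q, p, msg, -, rfl⟩ | ⟨p, z, -, rfl⟩
  · have := hS.delay_pos x.dst q x.entry.time
    simp only [Item.realTime]
    linarith
  · have := z.1.2
    simp only [Item.realTime]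
    linarith

lemma realTime_le_of_mem_pend {d u : ℝ} (hS : S.Valid s d u) {k l : ℕ} (hl : l < k)
    {x y : Item V n A.Msg A.Timer} (hx : S.pick A s l = some x) (hy : y ∈ (S.sim A s k).pend) :
    x.realTime s ≤ y.realTime s := by
  induction k generalizing y with
  | zero => omega
  | succ k ih =>
    have h1 : ∀ y ∈ (S.sim A s k).pend, x.realTime s ≤ y.realTime s := by
      intro y hy
      rcases Nat.lt_succ_iff_lt_or_eq.1 hl with hl | rfl
      · exact ih hl hy
      · exact Item.realTime_le_of_key_le ((firstItem_spec hx).2 y hy)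
    cases hp : S.pick A s k with
    | none =>
      rw [sim_succ_of_none hp] at hy
      exact h1 y hy
    | some z =>
      rw [sim_succ_of_some hp] at hy
      rcases hy with hy | hy
      · exact h1 y hy.1
      · exact (h1 z (firstItem_spec hp).1).trans (realTime_le_of_mem_newItems hS hy)

lemma exists_pick_of_deliversAt {k j p : ℕ} {q : Fin n} (h : (S.run A s).DeliversAt k q j p) :
    ∃ x, S.pick A s k = some x ∧ x.dst = q ∧ x.trig = .deliver j p := by
  obtain ⟨e, he, h1, h2⟩ := h
  obtain ⟨x, hx, rfl⟩ := event_eq_some_iff.1 he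
  exact ⟨x, hx, h1, h2⟩

lemma exists_pick_of_expiresAt {k j p : ℕ} (h : (S.run A s).ExpiresAt k j p) :
    ∃ x, S.pick A s k = some x ∧ x.trig = .expire j p := by
  obtain ⟨e, he, h2⟩ := h
  obtain ⟨x, hx, rfl⟩ := event_eq_some_iff.1 he
  exact ⟨x, hx, h2⟩

lemma exists_pick_of_invokesAt {k : ℕ} {i : Fin n} {op : Op V}
    (h : (S.run A s).InvokesAt k i op) :
    ∃ t, S.invoke i = some (t, op) ∧ S.pick A s k = some ⟨i, ⟨t, [0], .invoke op⟩, .invoke op⟩ := by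
  obtain ⟨e, he, h1, h2⟩ := h
  obtain ⟨x, hx, rfl⟩ := event_eq_some_iff.1 he
  obtain ⟨t, h3, h4⟩ := (born_of_pick hx).of_invoke h2
  simp only at h1
  subst h1
  exact ⟨t, h3, by rw [hx, ← h4]⟩

lemma exists_mem_newItems_of_send {j p : ℕ} {q : Fin n}
    (h : p < (((S.run A s).output A j).send q).length) :
    ∃ z y, S.pick A s j = some z ∧ y ∈ S.newItems A j (S.sim A s j).log z ∧
      y.dst = q ∧ y.trig = .deliver j p ∧
      y.realTime s = z.realTime s + (S.delay z.dst q z.entry.time + s q - s z.dst) := by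
  rw [output_run] at h
  cases hz : S.pick A s j with
  | none => simp [Scenario.simOut, hz, Output.empty] at h
  | some z =>
    rw [simOut_of_pick hz] at h
    refine ⟨z, _, rfl, Or.inl ⟨q, p, _, List.getElem?_eq_getElem h, rfl⟩, rfl, rfl, ?_⟩
    simp only [Item.realTime]
    ring

lemma exists_mem_newItems_of_timer {j p : ℕ} {x : ℝ≥0 × A.Timer}
    (h : ((S.run A s).output A j).timers[p]? = some x) :
    ∃ z y, S.pick A s j = some z ∧ y ∈ S.newItems A j (S.sim A s j).log z ∧
      y.trig = .expire j p ∧ y.realTime s = z.realTime s + x.1 := by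
  rw [output_run] at h
  cases hz : S.pick A s j with
  | none => simp [Scenario.simOut, hz, Output.empty] at h
  | some z =>
    rw [simOut_of_pick hz] at h
    refine ⟨z, _, rfl, Or.inr ⟨p, _, h, rfl⟩, rfl, ?_⟩
    simp only [Item.realTime]
    ring

lemma pick_or_mem_pend {j k : ℕ} (hjk : j < k) {z y : Item V n A.Msg A.Timer}
    (hz : S.pick A s j = some z) (hy : y ∈ S.newItems A j (S.sim A s j).log z) :
    (∃ l < k, S.pick A s l = some y) ∨ y ∈ (S.sim A s k).pend := by
  by_cases h : ∃ l < k, S.pick A s l = some y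
  · exact Or.inl h
  · push Not at h
    exact Or.inr (mem_pend_iff.2 ⟨Or.inr ⟨j, hjk, z, hz, hy⟩, h⟩)

theorem Scenario.Valid.isExecution {d u : ℝ} (hS : S.Valid s d u) :
    (S.run A s).IsExecution A d u where
  skew i j := by
    have := hS.skew j i
    simp only [Scenario.run]
    linarith
  time_mono j k e f hjk he hf := by
    obtain ⟨x, hx, rfl⟩ := event_eq_some_iff.1 he
    obtain ⟨y, hy, rfl⟩ := event_eq_some_iff.1 hf
    rcases hjk.eq_or_lt with rfl | hjk
    · rw [hx] at hy; cases hy; exact le_rfl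
    · exact realTime_le_of_mem_pend hS hjk hx (firstItem_spec hy).1
  input_valid k e he := by
    obtain ⟨x, hx, rfl⟩ := event_eq_some_iff.1 he
    rw [config_run, input_of_born (born_of_pick hx) (fun j hj => if_pos hj)]
    rfl
  deliver_once k l q j p hk hl := by
    obtain ⟨x, hx, hxd, hxt⟩ := exists_pick_of_deliversAt hk
    obtain ⟨y, hy, hyd, hyt⟩ := exists_pick_of_deliversAt hl
    obtain ⟨-, z, m, hz, hm, h1⟩ := (born_of_pick hx).of_deliver hxt
    obtain ⟨-, z', m', hz', hm', h2⟩ := (born_of_pick hy).of_deliver hyt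
    rw [hz] at hz'; cases hz'
    rw [hxd] at hm h1
    rw [hyd, hm] at hm'; cases hm'
    rw [hyd] at h2
    exact pick_injective hx (by rw [hy, h1, h2])
  deliver_time k q j p e f hk he hf := by
    obtain ⟨x, hx, hxd, hxt⟩ := exists_pick_of_deliversAt hk
    obtain ⟨-, z, m, hz, hm, h1⟩ := (born_of_pick hx).of_deliver hxt
    rw [event_of_pick hx] at he; cases he
    rw [event_of_pick hz] at hf; cases hf
    have h2 : x.realTime s =
        z.realTime s + (S.delay z.dst x.dst z.entry.time + s x.dst - s z.dst) := by
      rw [h1]; simp only [Item.realTime]; ring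
    have h3 := hS.le_delay z.dst x.dst z.entry.time
    have h4 := hS.delay_le z.dst x.dst z.entry.time
    simp only
    constructor <;> linarith
  expire_once k l j p hk hl := by
    obtain ⟨x, hx, hxt⟩ := exists_pick_of_expiresAt hk
    obtain ⟨y, hy, hyt⟩ := exists_pick_of_expiresAt hl
    obtain ⟨-, z, m, hz, hm, h1⟩ := (born_of_pick hx).of_expire hxt
    obtain ⟨-, z', m', hz', hm', h2⟩ := (born_of_pick hy).of_expire hyt
    rw [hz] at hz'; cases hz'
    rw [hm] at hm'; cases hm'
    exact pick_injective hx (by rw [hy, h1, h2])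
  expire_time k j p e f x hk he hf hx := by
    obtain ⟨y, hy, hyt⟩ := exists_pick_of_expiresAt hk
    obtain ⟨-, z, m, hz, hm, h1⟩ := (born_of_pick hy).of_expire hyt
    rw [output_run, simOut_of_pick hz, hm] at hx; cases hx
    rw [event_of_pick hy] at he; cases he
    rw [event_of_pick hz] at hf; cases hf
    rw [h1]; simp only [Item.realTime]; ring
  deliver_due j k q p e f hjk hf he hp := by
    obtain ⟨z, y, hz, hy, h1, h2, h3⟩ := exists_mem_newItems_of_send hp
    rw [event_of_pick hz] at hf; cases hf
    rcases pick_or_mem_pend hjk hz hy with ⟨l, hl, hyl⟩ | h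
    · exact Or.inl ⟨l, hl, _, event_of_pick hyl, h1, h2⟩
    · right
      obtain ⟨x, hx, rfl⟩ := event_eq_some_iff.1 he
      have h4 := Item.realTime_le_of_key_le ((firstItem_spec hx).2 y h)
      have h5 := hS.delay_le z.dst q z.entry.time
      simp only
      linarith
  expire_due j k p e f x hjk hf he hp := by
    obtain ⟨z, y, hz, hy, h2, h3⟩ := exists_mem_newItems_of_timer hp
    rw [event_of_pick hz] at hf; cases hf
    rcases pick_or_mem_pend hjk hz hy with ⟨l, hl, hyl⟩ | h
    · exact Or.inl ⟨l, hl, _, event_of_pick hyl, h2⟩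
    · right
      obtain ⟨x, hx, rfl⟩ := event_eq_some_iff.1 he
      have h4 := Item.realTime_le_of_key_le ((firstItem_spec hx).2 y h)
      simp only
      linarith
  invoke_not_pending j k i op op' hjk hj hk := by
    obtain ⟨t, h1, h2⟩ := exists_pick_of_invokesAt hj
    obtain ⟨t', h3, h4⟩ := exists_pick_of_invokesAt hk
    rw [h1] at h3; cases h3
    exact absurd (pick_injective h2 h4) hjk.ne
  enqueue_unique j k i i' x hj hk := by
    obtain ⟨t, h1, h2⟩ := exists_pick_of_invokesAt hj
    obtain ⟨t', h3, h4⟩ := exists_pick_of_invokesAt hk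
    obtain rfl := hS.enqueue_unique i i' t t' x h1 h3
    rw [h1] at h3; cases h3
    exact pick_injective h2 h4

/-! ### The local histories of the simulation -/

lemma log_succ_of_pick {k : ℕ} {x : Item V n A.Msg A.Timer} (h : S.pick A s k = some x) :
    (S.sim A s (k + 1)).log x.dst = (S.sim A s k).log x.dst ++ [x.entry] := by
  rw [sim_succ_of_some h]; simp

lemma log_succ_of_pick_ne {k : ℕ} {x : Item V n A.Msg A.Timer} (h : S.pick A s k = some x)
    {i : Fin n} (hi : i ≠ x.dst) :
    (S.sim A s (k + 1)).log i = (S.sim A s k).log i := by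
  rw [sim_succ_of_some h]; simp [Function.update_of_ne hi]

lemma log_prefix {k l : ℕ} (h : k ≤ l) (i : Fin n) :
    (S.sim A s k).log i <+: (S.sim A s l).log i := by
  induction l, h using Nat.le_induction with
  | base => exact List.prefix_rfl
  | succ l _ ih =>
    refine ih.trans ?_
    cases hp : S.pick A s l with
    | none => rw [sim_succ_of_none hp]
    | some x =>
      by_cases hi : i = x.dst
      · subst hi; rw [log_succ_of_pick hp]; exact List.prefix_append _ _
      · rw [log_succ_of_pick_ne hp hi]

lemma length_log_lt {k l : ℕ} {x : Item V n A.Msg A.Timer} (h : S.pick A s k = some x)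
    (hl : k < l) : ((S.sim A s k).log x.dst).length < ((S.sim A s l).log x.dst).length := by
  have := (log_prefix (S := S) (A := A) (s := s) (Nat.succ_le_of_lt hl) x.dst).length_le
  rw [Nat.succ_eq_add_one, log_succ_of_pick h] at this
  simp at this
  omega

lemma length_log_mono {k l : ℕ} (h : k ≤ l) (i : Fin n) :
    ((S.sim A s k).log i).length ≤ ((S.sim A s l).log i).length :=
  (log_prefix h i).length_le

lemma take_log {k l : ℕ} (h : k ≤ l) (i : Fin n) :
    ((S.sim A s l).log i).take ((S.sim A s k).log i).length = (S.sim A s k).log i :=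
  (List.prefix_iff_eq_take.1 (log_prefix h i)).symm

lemma getElem?_log_of_pick {k l : ℕ} {x : Item V n A.Msg A.Timer} (h : S.pick A s k = some x)
    (hl : k < l) : ((S.sim A s l).log x.dst)[((S.sim A s k).log x.dst).length]? = some x.entry := by
  have h1 := log_prefix (S := S) (A := A) (s := s) (Nat.succ_le_of_lt hl) x.dst
  rw [Nat.succ_eq_add_one, log_succ_of_pick h] at h1
  obtain ⟨t, ht⟩ := h1
  rw [← ht]
  simp

lemma exists_pick_of_getElem?_log {k m : ℕ} {i : Fin n} {e : Entry V A.Msg A.Timer}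
    (h : ((S.sim A s k).log i)[m]? = some e) :
    ∃ j < k, ∃ x, S.pick A s j = some x ∧ x.dst = i ∧ x.entry = e ∧
      ((S.sim A s j).log i).length = m := by
  induction k with
  | zero => simp [Scenario.sim] at h
  | succ k ih =>
    have lift : ((S.sim A s k).log i)[m]? = some e → ∃ j < k + 1, ∃ x, S.pick A s j = some x ∧
        x.dst = i ∧ x.entry = e ∧ ((S.sim A s j).log i).length = m := fun h => by
      obtain ⟨j, hj, h⟩ := ih h
      exact ⟨j, by omega, h⟩
    cases hp : S.pick A s k with
    | none =>
      rw [sim_succ_of_none hp] at h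
      exact lift h
    | some x =>
      by_cases hi : i = x.dst
      · subst hi
        rw [log_succ_of_pick hp] at h
        rcases lt_trichotomy m ((S.sim A s k).log x.dst).length with hm | hm | hm
        · rw [List.getElem?_append_left hm] at h
          exact lift h
        · subst hm
          simp only [List.getElem?_concat_length, Option.some.injEq] at h
          exact ⟨k, by omega, x, hp, rfl, h, rfl⟩
        · rw [List.getElem?_eq_none (by simp; omega)] at h
          cases h
      · rw [log_succ_of_pick_ne hp hi] at h
        exact lift h

lemma pick_eq_of_length_eq {k l : ℕ} {x y : Item V n A.Msg A.Timer} (hk : S.pick A s k = some x)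
    (hl : S.pick A s l = some y) (hd : x.dst = y.dst)
    (h : ((S.sim A s k).log x.dst).length = ((S.sim A s l).log y.dst).length) : k = l := by
  rcases lt_trichotomy k l with hkl | hkl | hkl
  · have := length_log_lt hk hkl
    rw [h, ← hd] at this
    exact absurd this (lt_irrefl _)
  · exact hkl
  · have := length_log_lt hl hkl
    rw [← h, hd] at this
    exact absurd this (lt_irrefl _)

lemma Born.eq_of_code_eq {k : ℕ} {x y : Item V n A.Msg A.Timer} (hx : Born S A s k x)
    (hy : Born S A s k y) (hd : x.dst = y.dst) (hc : x.entry.code = y.entry.code) : x = y := by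
  cases htx : x.trig with
  | invoke op =>
    obtain ⟨t, h1, h2⟩ := hx.of_invoke htx
    cases hty : y.trig with
    | invoke op' =>
      obtain ⟨t', h3, h4⟩ := hy.of_invoke hty
      rw [hd, h3] at h1; cases h1
      rw [h2, h4, hd]
    | deliver j' p' =>
      obtain ⟨-, z', m', hz', hm', h4⟩ := hy.of_deliver hty
      rw [h2, h4] at hc; simp at hc
    | expire j' p' =>
      obtain ⟨-, z', m', hz', hm', h4⟩ := hy.of_expire hty
      rw [h2, h4] at hc; simp at hc
  | deliver j p =>
    obtain ⟨-, z, m, hz, hm, h2⟩ := hx.of_deliver htx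
    cases hty : y.trig with
    | invoke op' =>
      obtain ⟨t', h3, h4⟩ := hy.of_invoke hty
      rw [h2, h4] at hc; simp at hc
    | deliver j' p' =>
      obtain ⟨-, z', m', hz', hm', h4⟩ := hy.of_deliver hty
      rw [h2, h4] at hc
      simp only [List.cons.injEq, add_left_inj, and_true] at hc
      obtain ⟨h5, h6, rfl⟩ := hc
      obtain rfl := pick_eq_of_length_eq hz hz' (Fin.ext h5) h6
      rw [hz] at hz'; cases hz'
      rw [hd, hm'] at hm; cases hm
      rw [h2, h4, hd]
    | expire j' p' =>
      obtain ⟨-, z', m', hz', hm', h4⟩ := hy.of_expire hty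
      rw [h2, h4] at hc
      simp only [List.cons.injEq, add_left_inj, and_true] at hc
      exact absurd hc.1 z.dst.2.ne
  | expire j p =>
    obtain ⟨-, z, m, hz, hm, h2⟩ := hx.of_expire htx
    cases hty : y.trig with
    | invoke op' =>
      obtain ⟨t', h3, h4⟩ := hy.of_invoke hty
      rw [h2, h4] at hc; simp at hc
    | deliver j' p' =>
      obtain ⟨-, z', m', hz', hm', h4⟩ := hy.of_deliver hty
      rw [h2, h4] at hc
      simp only [List.cons.injEq, add_left_inj, and_true] at hc
      exact absurd hc.1.symm z'.dst.2.ne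
    | expire j' p' =>
      obtain ⟨-, z', m', hz', hm', h4⟩ := hy.of_expire hty
      have hzd : z.dst = z'.dst := by rw [h2, h4] at hd; exact hd
      rw [h2, h4] at hc
      simp only [List.cons.injEq, true_and, and_true] at hc
      obtain ⟨h6, rfl⟩ := hc
      obtain rfl := pick_eq_of_length_eq hz hz' hzd h6
      rw [hz] at hz'; cases hz'
      rw [hm'] at hm; cases hm
      rw [h2, h4]

lemma Born.lt_length_log {k m p : ℕ} {y : Item V n A.Msg A.Timer} (hy : Born S A s k y)
    (hc : y.entry.code = [n + 1, m, p]) : m < ((S.sim A s k).log y.dst).length := by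
  cases hty : y.trig with
  | invoke op' =>
    obtain ⟨t', h3, h4⟩ := hy.of_invoke hty
    rw [h4] at hc; simp at hc
  | deliver j' p' =>
    obtain ⟨-, z', m', hz', hm', h4⟩ := hy.of_deliver hty
    rw [h4] at hc
    simp only [List.cons.injEq, add_left_inj, and_true] at hc
    exact absurd hc.1 z'.dst.2.ne
  | expire j' p' =>
    obtain ⟨hj, z', m', hz', hm', h4⟩ := hy.of_expire hty
    rw [h4] at hc
    simp only [List.cons.injEq, true_and, and_true] at hc
    have := length_log_lt hz' hj
    rw [h4, ← hc.1]
    exact this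

lemma Born.code_lt {k p : ℕ} {y : Item V n A.Msg A.Timer} (hy : Born S A s k y) :
    y.entry.code < [n + 1, ((S.sim A s k).log y.dst).length, p] := by
  cases hty : y.trig with
  | invoke op' =>
    obtain ⟨t', h3, h4⟩ := hy.of_invoke hty
    rw [h4]
    simp [List.cons_lt_cons_iff]
  | deliver j' p' =>
    obtain ⟨-, z', m', hz', hm', h4⟩ := hy.of_deliver hty
    rw [h4]
    simp [List.cons_lt_cons_iff]
  | expire j' p' =>
    obtain ⟨hj, z', m', hz', hm', h4⟩ := hy.of_expire hty
    have : y.entry.code = [n + 1, ((S.sim A s j').log z'.dst).length, p'] := by rw [h4]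
    rw [this]
    have := hy.lt_length_log this
    simp [List.cons_lt_cons_iff, this]

lemma time_le_of_mem_log {d u : ℝ} (hS : S.Valid s d u) {k : ℕ} {i : Fin n}
    {e : Entry V A.Msg A.Timer} (he : e ∈ (S.sim A s k).log i) {y : Item V n A.Msg A.Timer}
    (hy : y ∈ (S.sim A s k).pend) : e.time + s i ≤ y.realTime s := by
  obtain ⟨m, hm⟩ := List.mem_iff_getElem?.1 he
  obtain ⟨j, hj, x, hx, rfl, rfl, -⟩ := exists_pick_of_getElem?_log hm
  exact realTime_le_of_mem_pend hS hj hx hy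

/-- Items are executed in the order of local times and codes at each process: new messages arrive
later than everything executed so far as delays are positive, and a new timer, even one of
duration zero, comes after everything executed so far because of its code. -/
lemma log_lt_pend {d u : ℝ} (hS : S.Valid s d u) {k : ℕ} {y : Item V n A.Msg A.Timer}
    (hy : y ∈ (S.sim A s k).pend) {e : Entry V A.Msg A.Timer}
    (he : e ∈ (S.sim A s k).log y.dst) : e.key < y.entry.key := by
  induction k generalizing y e with
  | zero => simp [Scenario.sim] at he
  | succ k ih =>
    cases hp : S.pick A s k with
    | none => rw [sim_succ_of_none hp] at hy he; exact ih hy he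
    | some x =>
      have hxp := firstItem_spec hp
      -- the executed item comes before all others that are due at the same process
      have h1 : ∀ y ∈ (S.sim A s k).pend, y ≠ x → y.dst = x.dst → x.entry.key < y.entry.key := by
        intro y hy hne hd
        refine lt_of_le_of_ne (Item.entry_key_le_of_key_le (hxp.2 y hy) hd.symm) fun heq => ?_
        refine hne ((born_of_mem_pend hy).eq_of_code_eq (born_of_mem_pend hxp.1) hd ?_)
        have := congrArg (fun z => (ofLex z).2) heq
        exact this.symm
      have hy' := hy
      rw [sim_succ_of_some hp] at hy
      rcases hy with ⟨hy, hyx⟩ | hy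
      · by_cases hd : y.dst = x.dst
        · rw [hd, log_succ_of_pick hp, List.mem_append, List.mem_singleton] at he
          rcases he with he | rfl
          · exact ih hy (by rw [hd]; exact he)
          · exact h1 y hy hyx hd
        · rw [log_succ_of_pick_ne hp hd] at he
          exact ih hy he
      · rcases hy with ⟨q, p, msg, -, rfl⟩ | ⟨p, z, -, rfl⟩
        · have h2 : e.time + s q ≤ x.realTime s := by
            by_cases hd : q = x.dst
            · subst hd
              simp only at he
              rw [log_succ_of_pick hp, List.mem_append, List.mem_singleton] at he
              rcases he with he | rfl
              · exact time_le_of_mem_log hS he hxp.1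
              · exact le_rfl
            · simp only at he
              rw [log_succ_of_pick_ne hp hd] at he
              exact time_le_of_mem_log hS he hxp.1
          refine Prod.Lex.lt_iff.2 (Or.inl ?_)
          have := hS.delay_pos x.dst q x.entry.time
          simp only [Item.realTime] at h2
          change e.time < x.entry.time + S.delay x.dst q x.entry.time
          linarith
        · simp only at he
          rw [log_succ_of_pick hp, List.mem_append, List.mem_singleton] at he
          have h2 : e.key ≤ x.entry.key := by
            rcases he with he | rfl
            · exact (ih hxp.1 he).le
            · exact le_rfl
          refine h2.trans_lt (Prod.Lex.lt_iff.2 ?_)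
          rcases z.1.2.eq_or_lt with hz | hz
          · right
            refine ⟨?_, (born_of_mem_pend hxp.1).code_lt⟩
            change x.entry.time = x.entry.time + z.1
            have : (z.1 : ℝ) = 0 := hz.symm
            rw [this, add_zero]
          · left
            change x.entry.time < x.entry.time + z.1
            have : (0 : ℝ) < z.1 := hz
            linarith

lemma log_sorted {d u : ℝ} (hS : S.Valid s d u) (k : ℕ) (i : Fin n) :
    ((S.sim A s k).log i).Pairwise (fun e f => e.key < f.key) := by
  induction k with
  | zero => simp [Scenario.sim]
  | succ k ih =>
    cases hp : S.pick A s k with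
    | none => rw [sim_succ_of_none hp]; exact ih
    | some x =>
      by_cases hi : i = x.dst
      · subst hi
        rw [log_succ_of_pick hp, List.pairwise_append]
        refine ⟨ih, by simp, fun e he f hf => ?_⟩
        rw [List.mem_singleton] at hf
        subst hf
        exact log_lt_pend hS (firstItem_spec hp).1 he
      · rw [log_succ_of_pick_ne hp hi]; exact ih

/-- Once no item is due any more, the logs of the simulation are complete. -/
lemma isHistory_log {d u : ℝ} (hS : S.Valid s d u) {K : ℕ} (hK : (S.sim A s K).pend = ∅) :
    IsHistory A S (S.sim A s K).log where
  sorted := log_sorted hS K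
  mem_iff i e := by
    have hmem : ∀ y, Born S A s K y → y.entry ∈ (S.sim A s K).log y.dst := by
      intro y hy
      have : y ∉ (S.sim A s K).pend := by rw [hK]; simp
      rw [mem_pend_iff] at this
      push Not at this
      obtain ⟨l, hl, hly⟩ := this hy
      exact List.mem_of_getElem? (getElem?_log_of_pick hly hl)
    constructor
    · intro he
      obtain ⟨m, hm⟩ := List.mem_iff_getElem?.1 he
      obtain ⟨j, hj, x, hx, rfl, rfl, -⟩ := exists_pick_of_getElem?_log hm
      have hb := born_of_pick hx
      cases hty : x.trig with
      | invoke op' =>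
        obtain ⟨t', h3, h4⟩ := hb.of_invoke hty
        have h5 : x.entry = ⟨t', [0], .invoke op'⟩ := by rw [h4]
        rw [h5]
        exact .invoke t' op' h3
      | deliver j' p' =>
        obtain ⟨hj', z, msg, hz, hm', h4⟩ := hb.of_deliver hty
        have h5 := congrArg Item.entry h4
        rw [h5]
        refine .receive z.dst _ z.entry p' msg (getElem?_log_of_pick hz (hj'.trans hj)) ?_
        rw [take_log (hj'.trans hj).le]
        exact hm'
      | expire j' p' =>
        obtain ⟨hj', z, y, hz, hm', h4⟩ := hb.of_expire hty
        have h5 := congrArg Item.entry h4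
        have h6 : x.dst = z.dst := by rw [h4]
        rw [h5, h6]
        refine .expire _ z.entry p' y (getElem?_log_of_pick hz (hj'.trans hj)) ?_
        rw [take_log (hj'.trans hj).le]
        exact hm'
    -- each generated step belongs to an item, which has been executed
    · intro hg
      cases hg with
      | invoke t op h =>
        exact hmem ⟨i, ⟨t, [0], .invoke op⟩, .invoke op⟩ (Or.inl ⟨t, op, h, rfl⟩)
      | receive j m f p msg hf hp =>
        obtain ⟨a, ha, x, hx, rfl, rfl, rfl⟩ := exists_pick_of_getElem?_log hf
        rw [take_log ha.le] at hp
        exact hmem _ (Or.inr ⟨a, ha, x, hx, Or.inl ⟨i, p, msg, hp, rfl⟩⟩)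
      | expire m f p y hf hp =>
        obtain ⟨a, ha, x, hx, rfl, rfl, rfl⟩ := exists_pick_of_getElem?_log hf
        rw [take_log ha.le] at hp
        exact hmem ⟨x.dst, _, .expire a p⟩ (Or.inr ⟨a, ha, x, hx, Or.inr ⟨p, y, hp, rfl⟩⟩)
  causal i m m' p e he hc := by
    obtain ⟨a, ha, x, hx, rfl, rfl, rfl⟩ := exists_pick_of_getElem?_log he
    exact (born_of_pick hx).lt_length_log hc

/-! ### Quiescence -/

lemma finite_initItems : (S.initItems A.Msg A.Timer).Finite := by
  refine (Set.finite_range fun i : Fin n => (S.invoke i).map fun x =>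
    (⟨i, ⟨x.1, [0], .invoke x.2⟩, .invoke x.2⟩ : Item V n A.Msg A.Timer)).preimage
      (f := some) (Option.some_injective _).injOn |>.subset ?_
  rintro y ⟨t, op, h, hy⟩
  exact ⟨y.dst, by simp only [h, Option.map_some]; exact congrArg some hy.symm⟩

lemma finite_newItems {k : ℕ} {log : Fin n → List (Entry V A.Msg A.Timer)}
    {x : Item V n A.Msg A.Timer} : (S.newItems A k log x).Finite := by
  refine Set.Finite.union ?_ ?_
  · let o := outputAfter A x.dst (log x.dst) x.entry
    refine (Set.finite_iUnion (fun q : Fin n => Set.finite_range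
      fun p : Fin (o.send q).length => (⟨q, ⟨x.entry.time + S.delay x.dst q x.entry.time,
        [x.dst + 1, (log x.dst).length, p], .receive x.dst (o.send q)[p]⟩, .deliver k p⟩ :
          Item V n A.Msg A.Timer))).subset ?_
    rintro y ⟨q, p, msg, h, rfl⟩
    obtain ⟨hp, rfl⟩ := List.getElem?_eq_some_iff.1 h
    exact Set.mem_iUnion.2 ⟨q, ⟨p, hp⟩, rfl⟩
  · let o := outputAfter A x.dst (log x.dst) x.entry
    refine (Set.finite_range fun p : Fin o.timers.length =>
      (⟨x.dst, ⟨x.entry.time + o.timers[p].1, [n + 1, (log x.dst).length, p],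
        .expire o.timers[p].2⟩, .expire k p⟩ : Item V n A.Msg A.Timer)).subset ?_
    rintro y ⟨p, z, h, rfl⟩
    obtain ⟨hp, rfl⟩ := List.getElem?_eq_some_iff.1 h
    exact ⟨⟨p, hp⟩, rfl⟩

lemma finite_pend (k : ℕ) : (S.sim A s k).pend.Finite := by
  induction k with
  | zero => exact finite_initItems
  | succ k ih =>
    cases hp : S.pick A s k with
    | none => rw [sim_succ_of_none hp]; exact ih
    | some x =>
      rw [sim_succ_of_some hp]
      exact (ih.subset Set.sdiff_subset).union finite_newItems

lemma finite_invocations : (S.run A s).Invocations.Finite := by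
  refine (((finite_initItems (S := S) (A := A)).image some).preimage (f := S.pick A s) ?_).subset ?_
  · rintro k ⟨x, -, hx⟩ l - hkl
    exact pick_injective hx.symm (hkl.symm.trans hx.symm)
  · rintro k ⟨i, op, h⟩
    obtain ⟨t, h1, h2⟩ := exists_pick_of_invokesAt h
    exact ⟨_, ⟨t, op, h1, rfl⟩, h2.symm⟩

/-- The simulation ends, since the algorithm is quiescent; so the run is admissible. -/
lemma Scenario.Valid.exists_end {d u : ℝ} (hA : A.IsSetLinearizableImplementation d u)
    (hn : 1 ≤ n) (hS : S.Valid s d u) :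
    ∃ K, (S.run A s).IsAdmissible A d u ∧ (∀ k, K ≤ k → S.pick A s k = none) ∧
      (S.sim A s K).pend = ∅ := by
  have hfin := hA.quiescent n (S.run A s) hn hS.isExecution finite_invocations
  obtain ⟨K, hK⟩ := hfin.bddAbove
  have hK' : ∀ k, K + 1 ≤ k → S.pick A s k = none := by
    intro k hk
    by_contra h
    obtain ⟨x, hx⟩ := Option.ne_none_iff_exists'.1 h
    have := hK (a := k) (by simp [event_of_pick hx])
    omega
  have hpend : ∀ k, K + 1 ≤ k → (S.sim A s k).pend = ∅ := fun k hk =>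
    eq_empty_of_firstItem (finite_pend k) (hK' k hk)
  have hpick : ∀ {j : ℕ} {z y : Item V n A.Msg A.Timer}, S.pick A s j = some z →
      y ∈ S.newItems A j (S.sim A s j).log z → ∃ l, S.pick A s l = some y := by
    intro j z y hz hy
    rcases pick_or_mem_pend (k := max (K + 1) (j + 1)) (by omega) hz hy with ⟨l, -, h⟩ | h
    · exact ⟨l, h⟩
    · rw [hpend _ (le_max_left _ _)] at h
      exact absurd h (by simp)
  refine ⟨K + 1, ⟨hS.isExecution, ?_, ?_, ?_⟩, hK', hpend _ le_rfl⟩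
  · intro j q p hp
    obtain ⟨z, y, hz, hy, h1, h2, -⟩ := exists_mem_newItems_of_send hp
    obtain ⟨l, hl⟩ := hpick hz hy
    exact ⟨l, _, event_of_pick hl, h1, h2⟩
  · intro j p hp
    obtain ⟨z, y, hz, hy, h2, -⟩ := exists_mem_newItems_of_timer (List.getElem?_eq_getElem hp)
    obtain ⟨l, hl⟩ := hpick hz hy
    exact ⟨l, _, event_of_pick hl, h2⟩
  · intro t
    refine hfin.subset ?_
    rintro k ⟨e, he, -⟩
    simp [he]

/-! ### Responses and linearizations in terms of local histories -/

/-- In the history `l` of process `i`, the (first) response to the invocation is `r`, at local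
time `t`. -/
def Answers (A : UniformAlgorithm.{v, w} V) (i : ℕ) (l : List (Entry V A.Msg A.Timer))
    (r : Response V) (t : ℝ) : Prop :=
  ∃ a b e f op, l[a]? = some e ∧ e.inp = .invoke op ∧ a ≤ b ∧ l[b]? = some f ∧ f.time = t ∧
    (outputAfter A i (l.take b) f).response = some r ∧
    ∀ c g r', a ≤ c → c < b → l[c]? = some g → (outputAfter A i (l.take c) g).response ≠ some r'

lemma IsHistory.getElem?_inj {L : Fin n → List (Entry V A.Msg A.Timer)} (hL : IsHistory A S L)
    {i : Fin n} {a b : ℕ} {e : Entry V A.Msg A.Timer} (ha : (L i)[a]? = some e)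
    (hb : (L i)[b]? = some e) : a = b := by
  rcases lt_trichotomy a b with h | h | h
  · exact absurd (key_lt_of_sorted (hL.sorted i) ha hb h) (lt_irrefl _)
  · exact h
  · exact absurd (key_lt_of_sorted (hL.sorted i) hb ha h) (lt_irrefl _)

lemma IsHistory.eq_of_inp {L : Fin n → List (Entry V A.Msg A.Timer)} (hL : IsHistory A S L)
    {i : Fin n} {a : ℕ} {e : Entry V A.Msg A.Timer} {op : Op V} (ha : (L i)[a]? = some e)
    (he : e.inp = .invoke op) : ∃ t, S.invoke i = some (t, op) ∧ e = ⟨t, [0], .invoke op⟩ := by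
  cases (hL.mem_iff i e).1 (List.mem_of_getElem? ha) with
  | invoke t op' h =>
    simp only [Input.invoke.injEq] at he
    subst he
    exact ⟨t, h, rfl⟩
  | receive j m f p msg hf hp => cases he
  | expire m f p x hf hp => cases he

lemma Answers.unique {L : Fin n → List (Entry V A.Msg A.Timer)} (hL : IsHistory A S L)
    {i : Fin n} {r r' : Response V} {t t' : ℝ} (h : Answers A i (L i) r t)
    (h' : Answers A i (L i) r' t') : r = r' ∧ t = t' := by
  obtain ⟨a, b, e, f, op, h1, h2, h3, h4, h5, h6, h7⟩ := h
  obtain ⟨a', b', e', f', op', h1', h2', h3', h4', h5', h6', h7'⟩ := h'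
  obtain ⟨t1, ht1, rfl⟩ := hL.eq_of_inp h1 h2
  obtain ⟨t2, ht2, rfl⟩ := hL.eq_of_inp h1' h2'
  rw [ht1] at ht2; cases ht2
  obtain rfl := hL.getElem?_inj h1 h1'
  rcases lt_trichotomy b b' with hb | rfl | hb
  · exact absurd h6 (h7' b f r h3 hb h4)
  · rw [h4] at h4'; cases h4'
    rw [h6] at h6'; cases h6'
    exact ⟨rfl, h5.symm.trans h5'⟩
  · exact absurd h6' (h7 b' f' r' h3' hb h4')

lemma Answers.invoke_le {L : Fin n → List (Entry V A.Msg A.Timer)} (hL : IsHistory A S L)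
    {i : Fin n} {r : Response V} {t : ℝ} (h : Answers A i (L i) r t) :
    ∃ t₀ op, S.invoke i = some (t₀, op) ∧ t₀ ≤ t := by
  obtain ⟨a, b, e, f, op, h1, h2, h3, h4, h5, h6, h7⟩ := h
  obtain ⟨t1, ht1, rfl⟩ := hL.eq_of_inp h1 h2
  refine ⟨t1, op, ht1, ?_⟩
  have := Entry.time_le_of_key_le (key_le_of_sorted (hL.sorted i) h1 h4 h3)
  rw [← h5]
  exact this

/-- A response in the run of the simulation that matches an invocation is an answer in the local
history. -/
lemma answers_of_matches {K k m : ℕ} (hK' : ∀ k, K ≤ k → S.pick A s k = none) {op : Op V}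
    {r : Response V} (h : (S.run A s).Matches A k m op r) :
    ∃ i t₀ t, (S.run A s).InvokesAt k i op ∧
      S.invoke i = some (t₀, op) ∧ Answers A i ((S.sim A s K).log i) r t ∧
      (∃ e, (S.run A s).event k = some e ∧ e.time = t₀ + s i) ∧
      ∃ f, (S.run A s).event m = some f ∧ f.time = t + s i := by
  have hlt : ∀ {k x}, S.pick A s k = some x → k < K := by
    intro k x hx
    by_contra hcon
    rw [hK' k (not_lt.1 hcon)] at hx
    cases hx
  obtain ⟨i, h1, hkm, ⟨e, he, rfl, hr⟩, hno⟩ := h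
  obtain ⟨x, hx, rfl⟩ := event_eq_some_iff.1 he
  obtain ⟨t₀, h2, h3⟩ := exists_pick_of_invokesAt h1
  simp only at h1 h2 h3 hno ⊢
  refine ⟨x.dst, t₀, x.entry.time, h1, h2, ?_, ⟨_, event_of_pick h3, rfl⟩, _, he, rfl⟩
  have he1 := getElem?_log_of_pick h3 (hlt h3)
  refine ⟨((S.sim A s k).log x.dst).length, ((S.sim A s m).log x.dst).length, _, x.entry, op,
    he1, rfl, length_log_mono hkm _, getElem?_log_of_pick hx (hlt hx),
    rfl, ?_, ?_⟩
  · rw [take_log (hlt hx).le, ← simOut_of_pick hx, ← output_run]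
    exact hr
  · intro c g r' hac hcb hg hr'
    obtain ⟨l, hl, y, hy, hyd, rfl, rfl⟩ := exists_pick_of_getElem?_log hg
    rw [take_log hl.le, ← hyd, ← simOut_of_pick hy, ← output_run] at hr'
    refine hno l r' ?_ ?_ ⟨_, event_of_pick hy, hyd, hr'⟩
    · by_contra hcon
      have := length_log_lt hy (not_le.1 hcon)
      rw [hyd] at this
      omega
    · by_contra hcon
      have := length_log_mono (S := S) (A := A) (s := s) (not_lt.1 hcon) x.dst
      omega

lemma IsLegal.comp_equiv {ι κ : Type*} {inst : ι → OpInstance V} {pos : ι → ℕ}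
    (h : IsLegal inst pos) (e : κ ≃ ι) : IsLegal (inst ∘ e) (pos ∘ e) where
  enqueue_singleton a b x h1 h2 := e.injective (h.enqueue_singleton _ _ x h1 h2)
  dequeue_agree a b := h.dequeue_agree (e a) (e b)
  dequeue_some a x ha := by
    obtain ⟨f, ⟨h1, h2, h3⟩, h4⟩ := h.dequeue_some (e a) x ha
    refine ⟨e.symm f, ⟨by simpa using h1, by simpa using h2, fun b => h3 (e b)⟩, ?_⟩
    rintro g y ⟨h5, h6, h7⟩
    have := h4 (e g) y ⟨h5, h6, fun b hb => by simpa using h7 (e.symm b) (by simpa using hb)⟩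
    simpa using this
  dequeue_none a ha f x := by
    rintro ⟨h1, h2, h3⟩
    exact h.dequeue_none (e a) ha (e f) x
      ⟨h1, h2, fun b hb => by simpa using h3 (e.symm b) (by simpa using hb)⟩

/-- What is known about the responses in a run of an implementation, in terms of the local
histories `L`, if the clocks are `s` behind. As each process has at most one invocation,
processes stand for the operation instances. -/
structure Outcome (A : UniformAlgorithm.{v, w} V) (d u : ℝ) (S : Scenario V n) (s : Fin n → ℝ)
    (L : Fin n → List (Entry V A.Msg A.Timer)) : Prop where
  dequeueTime : ∀ i t₀ r t, S.invoke i = some (t₀, .dequeue) → Answers A i (L i) r t →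
    ENNReal.ofReal (t - t₀) ≤ A.dequeueTime d u
  linearizable : ∃ (inst : {i // (S.invoke i).isSome} → OpInstance V)
      (pos : {i // (S.invoke i).isSome} → ℕ),
    (∀ i : {i // (S.invoke i).isSome}, ∃ t₀ op r t, S.invoke i = some (t₀, op) ∧
      Answers A i.1 (L i) r t ∧
      OpInstance.ofPair op r = some (inst i)) ∧
    (∀ (i j : {i // (S.invoke i).isSome}) r t t₀ op,
      Answers A i.1 (L i) r t → S.invoke j = some (t₀, op) →
      t + s i < t₀ + s j → pos i < pos j) ∧
    IsLegal inst pos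

theorem exists_outcome {d u : ℝ} (hA : A.IsSetLinearizableImplementation d u)
    (hn : 1 ≤ n) (hS : S.Valid s d u) : ∃ L, IsHistory A S L ∧ Outcome A d u S s L := by
  obtain ⟨K, hadm, hK', hK⟩ := hS.exists_end hA hn
  have hL := isHistory_log hS hK
  refine ⟨(S.sim A s K).log, hL, ?_⟩
  -- the event of an invocation
  have hnum : ∀ i : {i // (S.invoke i).isSome}, ∃ k : (S.run A s).Invocations, ∃ op,
      (S.run A s).InvokesAt k i op := by
    rintro ⟨i, hi⟩
    obtain ⟨⟨t, op⟩, h⟩ := Option.isSome_iff_exists.1 hi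
    have hy : (⟨i, ⟨t, [0], .invoke op⟩, .invoke op⟩ : Item V n A.Msg A.Timer) ∉
      (S.sim A s K).pend := by rw [hK]; simp
    rw [mem_pend_iff] at hy
    push Not at hy
    obtain ⟨l, -, hl⟩ := hy (Or.inl ⟨t, op, h, rfl⟩)
    have : (S.run A s).InvokesAt l i op := ⟨_, event_of_pick hl, rfl, rfl⟩
    exact ⟨⟨l, i, op, this⟩, op, this⟩
  choose num opn hopn using hnum
  have hproc : ∀ {k i j op op'}, (S.run A s).InvokesAt k i op →
      (S.run A s).InvokesAt k j op' → i = j := by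
    rintro k i j op op' ⟨e, he, rfl, -⟩ ⟨e', he', rfl, -⟩
    rw [he] at he'; cases he'; rfl
  have huniq : ∀ {k l i op op'}, (S.run A s).InvokesAt k i op →
      (S.run A s).InvokesAt l i op' → k = l := by
    intro k l i op op' h1 h2
    obtain ⟨t, h1, h3⟩ := exists_pick_of_invokesAt h1
    obtain ⟨t', h2, h4⟩ := exists_pick_of_invokesAt h2
    rw [h1] at h2; cases h2
    exact pick_injective h3 h4
  have hbij : Function.Bijective num := by
    constructor
    · intro i j hij
      have := hopn i
      rw [hij] at this
      exact Subtype.ext (hproc this (hopn j))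
    · rintro ⟨k, i, op, hk⟩
      obtain ⟨t, ht, -⟩ := exists_pick_of_invokesAt hk
      exact ⟨⟨i, by simp [ht]⟩, Subtype.ext (huniq (hopn ⟨i, by simp [ht]⟩) hk)⟩
  constructor
  · intro i t₀ r t hi hr
    have h1 := hopn ⟨i, by simp [hi]⟩
    obtain ⟨m, r', hm⟩ := hA.live n _ hn hadm _ _ _ h1
    obtain ⟨i', t', t'', h2, h3, h4, ⟨e, he, het⟩, f, hf, hft⟩ := answers_of_matches hK' hm
    obtain rfl := hproc h1 h2
    simp only at h3 h4 het hft hm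
    obtain ⟨rfl, hop⟩ := Prod.mk.inj (Option.some.inj (hi.symm.trans h3))
    rw [← hop] at hm
    obtain ⟨rfl, rfl⟩ := hr.unique hL h4
    refine le_sSup ⟨n, _, _, m, r, e, f, hn, hadm, hm, he, hf, ?_⟩
    rw [het, hft]
    congr 1
    ring
  · obtain ⟨inst, pos, h1, h2, h3⟩ := hA.set_linearizable n _ hn hadm
    refine ⟨inst ∘ Equiv.ofBijective num hbij, pos ∘ Equiv.ofBijective num hbij, ?_, ?_,
      h3.comp_equiv _⟩
    · intro i
      obtain ⟨m, op, r, hm, hop⟩ := h1 (num i)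
      obtain ⟨i', t', t'', h4, h5, h6, -, -⟩ := answers_of_matches hK' hm
      obtain rfl := hproc (hopn i) h4
      exact ⟨t', op, r, t'', h5, h6, hop⟩
    · intro i j r t t₀ op hr hj hlt
      refine h2 _ _ ?_
      obtain ⟨m, op', r', hm, hop⟩ := h1 (num i)
      obtain ⟨i', t', t'', h4, h5, h6, -, f, hf, hft⟩ := answers_of_matches hK' hm
      obtain rfl := hproc (hopn i) h4
      obtain ⟨rfl, rfl⟩ := hr.unique hL h6
      obtain ⟨t1, h7, h8⟩ := exists_pick_of_invokesAt (hopn j)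
      rw [hj] at h7; cases h7
      refine ⟨m, op', r, f, _, hm, hf, event_of_pick h8, Or.inl ?_⟩
      rw [hft]
      exact hlt

end Simulation

variable {A : UniformAlgorithm.{v, w} V}

section Transfer

variable {S S' : Scenario V n} {L L' : Fin n → List (Entry V A.Msg A.Timer)}

lemma Answers.of_indist {β : Fin n → ℝ} {δ : ℝ} {i : Fin n} {r : Response V} {t : ℝ}
    (h : Answers A i (L i) r t) (hL : IsHistory A S L) (hL' : IsHistory A S' L')
    (hS : Indist S S' β) (hS' : Indist S' S β) (hδ0 : 0 < δ)
    (hδ : ∀ i j t, δ ≤ S.delay i j t) (hδ' : ∀ i j t, δ ≤ S'.delay i j t) (ht : t < β i) :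
    Answers A i (L' i) r t := by
  have key := hS.getElem?_iff hL hL' hS' hδ0 hδ hδ' i
  have take : ∀ {m : ℕ} {e : Entry V A.Msg A.Timer}, (L i)[m]? = some e → e.time < β i →
      (L i).take m = (L' i).take m := fun he het =>
    take_eq_of_agree (hL.sorted i) (fun a _ e h1 h2 => (key a e h1).1 h2) he het
  obtain ⟨a, b, e, f, op, h1, h2, h3, h4, h5, h6, h7⟩ := h
  have hf : f.time < β i := h5.trans_lt ht
  have he := (Entry.time_le_of_key_le (key_le_of_sorted (hL.sorted i) h1 h4 h3)).trans_lt hf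
  have h4' := (key b f hf).1 h4
  refine ⟨a, b, e, f, op, (key a e he).1 h1, h2, h3, h4', h5, take h4 hf ▸ h6, ?_⟩
  intro m g r' ham hmb hg
  have hg' := (Entry.time_le_of_key_le (key_lt_of_sorted (hL'.sorted i) hg h4' hmb).le).trans_lt hf
  have hg2 := (key m g hg').2 hg
  rw [← take hg2 hg']
  exact h7 m g r' ham hmb hg2

lemma Indist.refl_const (hδ : ∀ i j t, 0 ≤ S.delay i j t) (B : ℝ) :
    Indist S S (fun _ => B) where
  invoke _ _ _ _ h := h
  delay j i t h := ⟨by have := hδ j i t; linarith, rfl⟩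

/-- Complete runs in the same scenario give the same responses. -/
lemma Answers.unique_history {δ : ℝ} (hδ0 : 0 < δ) (hδ : ∀ i j t, δ ≤ S.delay i j t)
    (hL : IsHistory A S L) (hL' : IsHistory A S L') {i : Fin n} {r r' : Response V} {t t' : ℝ}
    (h : Answers A i (L i) r t) (h' : Answers A i (L' i) r' t') : r = r' ∧ t = t' := by
  have hr := Indist.refl_const (fun i j t => hδ0.le.trans (hδ i j t)) (t + 1)
  exact (h.of_indist hL hL' hr hr hδ0 hδ hδ (lt_add_one t)).unique hL' h'

end Transfer

/-! ### The scenarios of the lower bound -/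

/-- The data shared by all scenarios: processes `i < size` may invoke `Dequeue`, from the time
`start` on and `gap - skew` apart, and processes `i ≥ size` invoke `Enqueue(arg i)` at time
`enq i`; all times are local. Delays are `d - skew` (fast) and `d` (slow), and `skew` is the
amount by which clocks are shifted. -/
structure Schedule (V : Type v) : Type v where
  size : ℕ
  d : ℝ
  skew : ℝ
  gap : ℝ
  start : ℝ
  enq : ℕ → ℝ
  arg : ℕ → V

namespace Schedule

/-- The time at which process `i` invokes `Dequeue`. -/
def deq (P : Schedule V) (i : ℕ) : ℝ := P.start + i * (P.gap - P.skew)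

/-- The time at which a chain of fast messages that starts with the `Dequeue` of process `0`
and visits all processes in order reaches process `i`. -/
def chain (P : Schedule V) (i : ℕ) : ℝ := P.start + i * (P.d - P.skew)

open Classical in
/-- The scenario in which the processes in `I` invoke `Dequeue` and the messages from each `i ∈ J`
to `i + 1` are slow from the time `P.chain i` on. All other messages are fast if and only if they
go to a process with a larger index. -/
noncomputable def scenario (P : Schedule V) (n : ℕ) (I J : Set ℕ) : Scenario V n where
  invoke i := if (i : ℕ) < P.size then if (i : ℕ) ∈ I then some (P.deq i, .dequeue) else none
    else some (P.enq i, .enqueue (P.arg i))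
  delay i j t := if j ≤ i ∨ ((i : ℕ) + 1 = j ∧ (i : ℕ) ∈ J ∧ P.chain i ≤ t) then P.d
    else P.d - P.skew

/-- The conditions on the parameters that the argument needs: `P.gap` is a strict bound for the
duration of `Dequeue`, and `Enqueue` instances return so early that the real-time order of the
`Enqueue` instances, and their precedence over all `Dequeue` instances, survives shifts. -/
structure Good (P : Schedule V) (A : UniformAlgorithm.{v, w} V) (n : ℕ) (u : ℝ) : Prop where
  impl : A.IsSetLinearizableImplementation P.d u
  two_mul_size_le : 2 * P.size ≤ n
  skew_nonneg : 0 ≤ P.skew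
  skew_le : P.skew ≤ (1 - 1 / (n : ℝ)) * u
  skew_le_u : P.skew ≤ u
  skew_lt : P.skew < P.d
  skew_le_gap : P.skew ≤ P.gap
  two_mul_gap_le : 2 * P.gap ≤ P.d + P.skew
  dequeueTime_lt : A.dequeueTime P.d u < ENNReal.ofReal P.gap
  arg_injective : Function.Injective P.arg
  enq_answers : ∀ I J L, IsHistory A (P.scenario n I J) L → ∀ i : Fin n, P.size ≤ i →
    ∃ r t, Answers A i (L i) r t ∧ t + P.skew < P.start ∧
      ∀ j : Fin n, i < j → t + P.skew < P.enq j

variable {P : Schedule V} {I J I' J' : Set ℕ} {u : ℝ}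

lemma invoke_dequeue {i : Fin n} (hi : (i : ℕ) < P.size) (hI : (i : ℕ) ∈ I) :
    (P.scenario n I J).invoke i = some (P.deq i, .dequeue) := by
  simp [scenario, hi, hI]

lemma invoke_enqueue {i : Fin n} (hi : P.size ≤ i) :
    (P.scenario n I J).invoke i = some (P.enq i, .enqueue (P.arg i)) := by
  simp [scenario, not_lt.2 hi]

lemma invoke_eq_dequeue {i : Fin n} {t : ℝ}
    (h : (P.scenario n I J).invoke i = some (t, .dequeue)) :
    (i : ℕ) < P.size ∧ (i : ℕ) ∈ I ∧ t = P.deq i := by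
  simp only [scenario] at h
  split_ifs at h with h1 h2 <;> simp_all

lemma invoke_eq_enqueue {i : Fin n} {t : ℝ} {x : V}
    (h : (P.scenario n I J).invoke i = some (t, .enqueue x)) :
    P.size ≤ (i : ℕ) ∧ t = P.enq i ∧ x = P.arg i := by
  simp only [scenario] at h
  split_ifs at h with h1 h2 <;> simp_all

namespace Good

lemma le_delay (h : P.Good A n u) (i j : Fin n) (t : ℝ) :
    P.d - P.skew ≤ (P.scenario n I J).delay i j t := by
  have := h.skew_nonneg
  simp only [scenario]
  split_ifs <;> linarith

lemma d_sub_skew_pos (h : P.Good A n u) : 0 < P.d - P.skew := sub_pos.2 h.skew_lt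

lemma gap_lt (h : P.Good A n u) : P.gap < P.d := by
  have := h.two_mul_gap_le
  have := h.skew_lt
  linarith

lemma deq_mono (h : P.Good A n u) {i j : ℕ} (hij : i ≤ j) : P.deq i ≤ P.deq j := by
  have h1 : (i : ℝ) ≤ j := by exact_mod_cast hij
  have h2 := h.skew_le_gap
  simp only [deq]
  nlinarith

lemma deq_succ (i : ℕ) : P.deq (i + 1) = P.deq i + (P.gap - P.skew) := by
  simp only [deq]; push_cast; ring

lemma chain_succ (i : ℕ) : P.chain (i + 1) = P.chain i + (P.d - P.skew) := by
  simp only [chain]; push_cast; ring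

lemma deq_le_chain (h : P.Good A n u) (i : ℕ) : P.deq i ≤ P.chain i := by
  have h1 : (0 : ℝ) ≤ i := i.cast_nonneg
  have h2 := h.gap_lt
  simp only [deq, chain]
  nlinarith

/-- The clocks of the processes from `p` on may be `skew` behind, if no message from a process
before `p` to one of these is slow. -/
lemma valid (h : P.Good A n u) {p : ℕ} (hJ : ∀ i ∈ J, i + 1 ≠ p) :
    (P.scenario n I J).Valid (fun i => if p ≤ (i : ℕ) then P.skew else 0) P.d u := by
  have h1 := h.skew_nonneg
  have h2 := h.skew_lt
  have h3 := h.skew_le_u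
  have h4 := h.skew_le
  have hdelay : ∀ (i j : Fin n) (t : ℝ), P.d - P.skew ≤ (P.scenario n I J).delay i j t +
      (if p ≤ (j : ℕ) then P.skew else 0) - (if p ≤ (i : ℕ) then P.skew else 0) ∧
      (P.scenario n I J).delay i j t +
      (if p ≤ (j : ℕ) then P.skew else 0) - (if p ≤ (i : ℕ) then P.skew else 0) ≤ P.d := by
    intro i j t
    simp only [scenario]
    split_ifs with h5 h6 h7 h6 h6 h6
    all_goals first
      | (constructor <;> linarith)
      | exfalso
        rcases h5 with h5 | ⟨h5, h7, -⟩
        · have : (j : ℕ) ≤ i := h5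
          omega
        · have := hJ _ h7
          omega
      | exfalso
        rw [not_or, not_le] at h5
        have : (i : ℕ) < j := h5.1
        omega
  refine ⟨fun i j => ?_, fun i j t => ?_, fun i j t => ?_, fun i j t => (hdelay i j t).2, ?_⟩
  · split_ifs <;> linarith
  · have := (hdelay i j t).1
    linarith
  · have := (hdelay i j t).1
    linarith
  · intro i j t t' x hi hj
    have h5 := (invoke_eq_enqueue hi).2.2
    have h6 := (invoke_eq_enqueue hj).2.2
    exact Fin.ext (h.arg_injective (h5.symm.trans h6))

end Good

/-- `Dequeue` of process `i` returns `v`, in less than the time `P.gap`, in the scenario given by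
`I` and `J`. -/
def Returns (P : Schedule V) (A : UniformAlgorithm.{v, w} V) (n : ℕ) (I J : Set ℕ) (i : ℕ)
    (v : Option V) : Prop :=
  ∃ (q : Fin n) (L : Fin n → List (Entry V A.Msg A.Timer)) (t : ℝ), (q : ℕ) = i ∧
    IsHistory A (P.scenario n I J) L ∧ Answers A q (L q) (.value v) t ∧ t < P.deq i + P.gap

lemma Good.returns_unique (h : P.Good A n u) {i : ℕ} {v v' : Option V}
    (hv : P.Returns A n I J i v) (hv' : P.Returns A n I J i v') : v = v' := by
  obtain ⟨q, L, t, rfl, hL, h1, -⟩ := hv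
  obtain ⟨q', L', t', hq, hL', h2, -⟩ := hv'
  obtain rfl := Fin.ext hq
  have := (h1.unique_history h.d_sub_skew_pos h.le_delay hL hL' h2).1
  simpa using this

lemma Good.lt_deq_add_gap (h : P.Good A n u) {s : Fin n → ℝ}
    {L : Fin n → List (Entry V A.Msg A.Timer)} (hO : Outcome A P.d u (P.scenario n I J) s L)
    {i : Fin n} (hi : (i : ℕ) < P.size) (hI : (i : ℕ) ∈ I) {r : Response V} {t : ℝ}
    (hr : Answers A i (L i) r t) : t < P.deq i + P.gap := by
  have h1 := hO.dequeueTime i _ r t (invoke_dequeue hi hI) hr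
  have h2 := (ENNReal.ofReal_lt_ofReal_iff'.1 (h1.trans_lt h.dequeueTime_lt)).1
  linarith

lemma Good.lt_and_one_le_of_lt_size (h : P.Good A n u) {i : ℕ} (hi : i < P.size) :
    i < n ∧ 1 ≤ n := by
  have := h.two_mul_size_le
  omega

lemma ofPair_dequeue {r : Response V} {o : OpInstance V}
    (h : OpInstance.ofPair .dequeue r = some o) : ∃ v, r = .value v ∧ o = .dequeue v := by
  cases r with
  | ack => simp [OpInstance.ofPair] at h
  | value v =>
    simp only [OpInstance.ofPair, Option.some.injEq] at h
    exact ⟨v, rfl, h.symm⟩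

lemma ofPair_enqueue {r : Response V} {o : OpInstance V} {x : V}
    (h : OpInstance.ofPair (.enqueue x) r = some o) : o = .enqueue x := by
  cases r with
  | ack =>
    simp only [OpInstance.ofPair, Option.some.injEq] at h
    exact h.symm
  | value v => simp [OpInstance.ofPair] at h

lemma Good.exists_returns (h : P.Good A n u) {i : ℕ} (hi : i < P.size) (hI : i ∈ I) :
    ∃ v, P.Returns A n I J i v := by
  obtain ⟨hin, hn⟩ := h.lt_and_one_le_of_lt_size hi
  obtain ⟨L, hL, hO⟩ := exists_outcome h.impl hn (h.valid (p := 0) (I := I) (J := J) (by simp))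
  have hinv := invoke_dequeue (P := P) (n := n) (J := J) (i := ⟨i, hin⟩) hi hI
  obtain ⟨inst, pos, h1, -, -⟩ := hO.linearizable
  obtain ⟨t₀, op, r, t, h2, h3, h4⟩ := h1 ⟨⟨i, hin⟩, by simp [hinv]⟩
  obtain ⟨-, rfl⟩ := Prod.mk.inj (Option.some.inj (hinv.symm.trans h2))
  obtain ⟨v, rfl, -⟩ := ofPair_dequeue h4
  exact ⟨v, _, L, t, rfl, hL, h3, h.lt_deq_add_gap hO hi hI h3⟩

/-! ### Comparing scenarios -/

open Classical in
/-- If two scenarios differ only in what process `p` learns or does from time `B` on, then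
process `i` does not notice before time `P.horizon p B e i`. Processes before `p` are reached by
messages with delay `P.d`, those after `p` by messages with delay `P.d - P.skew`; `e` stands for
the case that messages from `p` to `p + 1` are slow. -/
noncomputable def horizon (P : Schedule V) (p : ℕ) (B : ℝ) (e : Prop) (i : ℕ) : ℝ :=
  if i = p then B else if i < p ∨ (e ∧ i = p + 1) then B + P.d else B + (P.d - P.skew)

lemma Good.indist (h : P.Good A n u) {p : ℕ} {B : ℝ} {e : Prop}
    (hI : ∀ i, (i ∈ I ↔ i ∈ I') ∨ P.horizon p B e i ≤ P.deq i)
    (hJ : ∀ i, (i ∈ J ↔ i ∈ J') ∨ (i + 1 = p ∧ B ≤ P.chain i + (P.d - P.skew)))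
    (he : e → p ∈ J ∧ P.chain p ≤ B) :
    Indist (P.scenario n I J) (P.scenario n I' J') (fun i => P.horizon p B e i) := by
  have h1 := h.skew_nonneg
  have h2 := h.skew_lt
  refine ⟨fun i t op ht hi => ?_, fun j i t ht => ⟨?_, ?_⟩⟩
  · cases op with
    | enqueue x =>
      obtain ⟨h3, rfl, rfl⟩ := invoke_eq_enqueue hi
      exact invoke_enqueue h3
    | dequeue =>
      obtain ⟨h3, h4, rfl⟩ := invoke_eq_dequeue hi
      rcases hI i with h5 | h5
      · exact invoke_dequeue h3 (h5.1 h4)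
      · exact absurd ht (not_lt.2 h5)
  · have hd := h.le_delay (I := I) (J := J) j i t
    have hslow : i ≤ j ∨ ((j : ℕ) + 1 = i ∧ (j : ℕ) ∈ J ∧ P.chain j ≤ t) →
        (P.scenario n I J).delay j i t = P.d := fun hc => if_pos hc
    by_contra hcon
    rw [not_lt] at hcon
    rcases lt_trichotomy (j : ℕ) p with hj | hj | hj
    · have h3 : P.horizon p B e j = B + P.d := by
        rw [horizon, if_neg hj.ne, if_pos (Or.inl hj)]
      have h4 : P.horizon p B e i ≤ B + P.d := by
        rw [horizon]; split_ifs <;> linarith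
      linarith
    · have h3 : P.horizon p B e j = B := by rw [horizon, if_pos hj]
      rcases lt_trichotomy (i : ℕ) p with hi | hi | hi
      · have h4 : P.horizon p B e i = B + P.d := by
          rw [horizon, if_neg hi.ne, if_pos (Or.inl hi)]
        have := hslow (Or.inl (Fin.le_def.2 (by omega)))
        linarith
      · have h4 : P.horizon p B e i = B := by rw [horizon, if_pos hi]
        linarith
      · by_cases hei : e ∧ (i : ℕ) = p + 1
        · have h4 : P.horizon p B e i = B + P.d := by
            rw [horizon, if_neg hi.ne', if_pos (Or.inr hei)]
          obtain ⟨h5, h6⟩ := he hei.1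
          have := hslow (Or.inr ⟨by omega, hj ▸ h5, by rw [hj]; linarith⟩)
          linarith
        · have h4 : P.horizon p B e i = B + (P.d - P.skew) := by
            rw [horizon, if_neg hi.ne', if_neg (by rw [not_or]; exact ⟨by omega, hei⟩)]
          linarith
    · by_cases hej : e ∧ (j : ℕ) = p + 1
      · have h3 : P.horizon p B e j = B + P.d := by
          rw [horizon, if_neg hj.ne', if_pos (Or.inr hej)]
        have h4 : P.horizon p B e i ≤ B + P.d := by
          rw [horizon]; split_ifs <;> linarith
        linarith
      · have h3 : P.horizon p B e j = B + (P.d - P.skew) := by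
          rw [horizon, if_neg hj.ne', if_neg (by rw [not_or]; exact ⟨by omega, hej⟩)]
        by_cases hi : (i : ℕ) < p ∨ (e ∧ (i : ℕ) = p + 1)
        · have h4 : P.horizon p B e i = B + P.d := by
            rw [horizon, if_neg (by omega), if_pos hi]
          have := hslow (Or.inl (Fin.le_def.2 (by
            rcases hi with hi | hi
            · omega
            · have : (j : ℕ) ≠ p + 1 := fun hj => hej ⟨hi.1, hj⟩
              omega)))
          linarith
        · have h4 : P.horizon p B e i ≤ B + (P.d - P.skew) := by
            rw [horizon, if_neg hi]; split_ifs <;> linarith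
          linarith
  · have hd := h.le_delay (I := I) (J := J) j i t
    simp only [scenario]
    congr 1
    rw [eq_iff_iff]
    refine or_congr Iff.rfl (and_congr_right fun h3 => ?_)
    rcases hJ j with h4 | ⟨h4, h5⟩
    · rw [h4]
    · have h6 : P.horizon p B e i = B := by rw [horizon, if_pos (by omega)]
      have h7 : ¬ P.chain j ≤ t := by
        intro h7
        simp only [h6] at ht
        linarith
      simp [h7]

lemma Good.returns_of_indist (h : P.Good A n u) {p : ℕ} {B : ℝ} {e : Prop}
    (hI : ∀ i, (i ∈ I ↔ i ∈ I') ∨ P.horizon p B e i ≤ P.deq i)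
    (hJ : ∀ i, (i ∈ J ↔ i ∈ J') ∨ (i + 1 = p ∧ B ≤ P.chain i + (P.d - P.skew)))
    (he : e → p ∈ J ∧ p ∈ J' ∧ P.chain p ≤ B) {i : ℕ} (hi : P.deq i + P.gap ≤ P.horizon p B e i)
    {v : Option V} (hv : P.Returns A n I J i v) : P.Returns A n I' J' i v := by
  obtain ⟨q, L, t, rfl, hL, h1, h2⟩ := hv
  obtain ⟨L', hL', -⟩ := exists_outcome h.impl q.pos
    (h.valid (p := 0) (I := I') (J := J') (by simp))
  refine ⟨q, L', t, rfl, hL', h1.of_indist hL hL'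
    (h.indist hI hJ fun h3 => ⟨(he h3).1, (he h3).2.2⟩)
    (h.indist (fun i => (hI i).imp Iff.symm id) (fun i => (hJ i).imp Iff.symm id)
      fun h3 => (he h3).2) h.d_sub_skew_pos h.le_delay h.le_delay (h2.trans_le hi), h2⟩

lemma Good.returns_iff (h : P.Good A n u) {p : ℕ} {B : ℝ} (e : Prop)
    (hI : ∀ i, (i ∈ I ↔ i ∈ I') ∨ P.horizon p B e i ≤ P.deq i)
    (hJ : ∀ i, (i ∈ J ↔ i ∈ J') ∨ (i + 1 = p ∧ B ≤ P.chain i + (P.d - P.skew)))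
    (he : e → p ∈ J ∧ p ∈ J' ∧ P.chain p ≤ B) {i : ℕ} (hi : P.deq i + P.gap ≤ P.horizon p B e i)
    (v : Option V) : P.Returns A n I J i v ↔ P.Returns A n I' J' i v :=
  ⟨h.returns_of_indist hI hJ he hi,
    h.returns_of_indist (fun i => (hI i).imp Iff.symm id) (fun i => (hJ i).imp Iff.symm id)
      (fun h3 => ⟨(he h3).2.1, (he h3).1, (he h3).2.2⟩) hi⟩

/-! ### The last `Dequeue` -/

/-- `v` is the first of the enqueued values that is not in `R`. -/
def IsFirstNotIn (P : Schedule V) (R : Set (Option V)) (v : Option V) : Prop :=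
  ∃ a, P.size ≤ a ∧ v = some (P.arg a) ∧ v ∉ R ∧
    ∀ b, P.size ≤ b → b < a → some (P.arg b) ∈ R

/-- The values returned by the processes before `p`. -/
def before (P : Schedule V) (A : UniformAlgorithm.{v, w} V) (n : ℕ) (I J : Set ℕ) (p : ℕ) :
    Set (Option V) :=
  {v | ∃ i < p, P.Returns A n I J i v}

/-- There are more enqueued values than processes before `p`. -/
lemma Good.exists_arg_notMem_before (h : P.Good A n u) {p : ℕ} (hp : p < P.size) :
    ∃ a : Fin n, P.size ≤ a ∧ some (P.arg a) ∉ P.before A n I J p := by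
  by_contra hcon
  push Not at hcon
  have hn := h.two_mul_size_le
  have hcon' : ∀ a ∈ Finset.Ico P.size n, ∃ i, i < p ∧ P.Returns A n I J i (some (P.arg a)) := by
    intro a ha
    rw [Finset.mem_Ico] at ha
    exact hcon ⟨a, ha.2⟩ ha.1
  choose! f hf using hcon'
  obtain ⟨a, ha, b, hb, hab, hfab⟩ := Finset.exists_ne_map_eq_of_card_lt_of_maps_to
    (s := Finset.Ico P.size n) (t := Finset.range p) (f := f) (by simp; omega)
    (fun a ha => by simpa using (hf a ha).1)
  refine hab (h.arg_injective ?_)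
  have h1 := (hf a ha).2
  rw [hfab] at h1
  exact Option.some.inj (h.returns_unique h1 (hf b hb).2)

/-- If process `p` is the last to invoke `Dequeue`, then shifting the processes from `p` on by
`skew` moves this invocation behind all other responses. So it returns the first value that no
other process returns. -/
theorem Good.exists_last_returns (h : P.Good A n u) {p : ℕ} (hp : p < P.size) (hpI : p ∈ I)
    (hI : ∀ i ∈ I, i ≤ p) (hJ : ∀ i ∈ J, i + 1 ≠ p) :
    ∃ v, P.Returns A n I J p v ∧ P.IsFirstNotIn (P.before A n I J p) v := by
  obtain ⟨hpn, hn⟩ := h.lt_and_one_le_of_lt_size hp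
  have hσ := h.skew_nonneg
  have hgap := h.skew_le_gap
  obtain ⟨L, hL, hO⟩ := exists_outcome h.impl hn (h.valid (I := I) hJ)
  obtain ⟨inst, pos, h1, h2, h3⟩ := hO.linearizable
  have hshift : ∀ i : Fin n, 0 ≤ (if p ≤ (i : ℕ) then P.skew else 0) ∧
      (if p ≤ (i : ℕ) then P.skew else 0) ≤ P.skew := fun i => by split_ifs <;> simp [hσ]
  -- the instances of `Dequeue`
  have hdeq : ∀ i : {i // ((P.scenario n I J).invoke i).isSome}, (i.1 : ℕ) < P.size →
      (i.1 : ℕ) ∈ I ∧ ∃ v t, inst i = .dequeue v ∧ Answers A i.1 (L i) (.value v) t ∧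
        t < P.deq i.1 + P.gap := by
    intro i hi
    obtain ⟨t₀, op, r, t, h4, h5, h6⟩ := h1 i
    have hop : op = .dequeue := by
      cases op with
      | dequeue => rfl
      | enqueue x => exact absurd hi (not_lt.2 (invoke_eq_enqueue h4).1)
    subst hop
    obtain ⟨v, rfl, hv⟩ := ofPair_dequeue h6
    have hiI := (invoke_eq_dequeue h4).2.1
    exact ⟨hiI, v, t, hv, h5, h.lt_deq_add_gap hO hi hiI h5⟩
  have henq : ∀ i : {i // ((P.scenario n I J).invoke i).isSome}, P.size ≤ (i.1 : ℕ) →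
      inst i = .enqueue (P.arg i.1) := by
    intro i hi
    obtain ⟨t₀, op, r, t, h4, h5, h6⟩ := h1 i
    rw [invoke_enqueue hi] at h4
    cases h4
    exact ofPair_enqueue h6
  have hof_enq : ∀ i : {i // ((P.scenario n I J).invoke i).isSome}, ∀ x, inst i = .enqueue x →
      P.size ≤ (i.1 : ℕ) ∧ x = P.arg i.1 := by
    intro i x hx
    by_cases hi : (i.1 : ℕ) < P.size
    · obtain ⟨-, v, t, hv, -⟩ := hdeq i hi
      rw [hv] at hx; cases hx
    · rw [henq i (not_lt.1 hi)] at hx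
      cases hx
      exact ⟨not_lt.1 hi, rfl⟩
  let enq (i : Fin n) (hi : P.size ≤ (i : ℕ)) : {i // ((P.scenario n I J).invoke i).isSome} :=
    ⟨i, by simp [invoke_enqueue hi]⟩
  have hpinv := invoke_dequeue (P := P) (J := J) (i := ⟨p, hpn⟩) hp hpI
  let q : {i // ((P.scenario n I J).invoke i).isSome} := ⟨⟨p, hpn⟩, by simp [hpinv]⟩
  -- the real-time order
  have hpos_enq : ∀ i j : {i // ((P.scenario n I J).invoke i).isSome}, P.size ≤ (i.1 : ℕ) →
      i.1 < j.1 → pos i < pos j := by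
    intro i j hi hij
    obtain ⟨r, t, h4, -, h5⟩ := h.enq_answers I J L hL i.1 hi
    have hj : P.size ≤ (j.1 : ℕ) := hi.trans (Fin.le_def.1 hij.le)
    refine h2 i j r t _ _ h4 (invoke_enqueue hj) ?_
    have := h5 j.1 hij
    have := (hshift i.1).2
    have := (hshift j.1).1
    linarith
  have hpos_q : ∀ i : {i // ((P.scenario n I J).invoke i).isSome}, P.size ≤ (i.1 : ℕ) →
      pos i < pos q := by
    intro i hi
    obtain ⟨r, t, h4, h5, -⟩ := h.enq_answers I J L hL i.1 hi
    refine h2 i q r t _ _ h4 hpinv ?_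
    have := (hshift i.1).2
    have := (hshift q.1).1
    have h6 : P.start ≤ P.deq p := by
      have := h.deq_mono (Nat.zero_le p)
      simpa [deq] using this
    simp only [q] at this ⊢
    linarith
  have hpos_deq : ∀ i : {i // ((P.scenario n I J).invoke i).isSome}, (i.1 : ℕ) < p →
      pos i < pos q := by
    intro i hi
    obtain ⟨hiI, v, t, -, h4, h5⟩ := hdeq i (hi.trans hp)
    refine h2 i q _ t _ _ h4 hpinv ?_
    have h6 : P.deq i.1 + (P.gap - P.skew) ≤ P.deq p := by
      rw [← Good.deq_succ]
      exact h.deq_mono hi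
    simp only [q]
    rw [if_neg (not_le.2 hi), if_pos le_rfl]
    linarith
  have hmem : ∀ v, v ∈ P.before A n I J p ↔
      ∃ i : {i // ((P.scenario n I J).invoke i).isSome}, pos i < pos q ∧ inst i = .dequeue v := by
    intro v
    constructor
    · rintro ⟨-, hi, i, L', t, rfl, hL', h4, h5⟩
      obtain ⟨t₀, op, h6, -⟩ := h4.invoke_le hL'
      refine ⟨⟨i, by simp [h6]⟩, hpos_deq _ hi, ?_⟩
      obtain ⟨-, v', t', h7, h8, -⟩ := hdeq ⟨i, by simp [h6]⟩ (hi.trans hp)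
      rw [h7]
      have := (h4.unique_history h.d_sub_skew_pos h.le_delay hL' hL h8).1
      simp only [Response.value.injEq] at this
      rw [this]
    · rintro ⟨i, h4, h5⟩
      have hi : (i.1 : ℕ) < P.size := by
        by_contra hcon
        rw [henq i (not_lt.1 hcon)] at h5
        cases h5
      obtain ⟨hiI, v', t, h6, h7, h8⟩ := hdeq i hi
      rw [h6] at h5; cases h5
      refine ⟨i.1, lt_of_le_of_ne (hI _ hiI) fun hip => ?_, i.1, L, t, rfl, hL, h7, h8⟩
      have : i = q := Subtype.ext (Fin.ext hip)
      rw [this] at h4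
      exact lt_irrefl _ h4
  -- enqueued values which are not returned are available
  have havail : ∀ (a : Fin n) (ha : P.size ≤ (a : ℕ)), some (P.arg a) ∉ P.before A n I J p →
      Available inst pos q (enq a ha) (P.arg a) := by
    intro a ha hnot
    refine ⟨henq _ ha, hpos_q _ ha, fun b hb hb' => hnot ((hmem _).2 ⟨b, hb, hb'⟩)⟩
  obtain ⟨-, v, t, hv, h4, h5⟩ := hdeq q hp
  refine ⟨v, ⟨_, L, t, rfl, hL, h4, h5⟩, ?_⟩
  cases v with
  | none =>
    obtain ⟨a, ha, hnot⟩ := h.exists_arg_notMem_before (I := I) (J := J) hp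
    exact absurd (havail a ha hnot) (h3.dequeue_none q hv _ _)
  | some y =>
    obtain ⟨e, ⟨he, -, h6⟩, h7⟩ := h3.dequeue_some q y hv
    obtain ⟨hes, rfl⟩ := hof_enq e y he
    refine ⟨e.1, hes, rfl, fun hcon => ?_, fun b hb hbe => ?_⟩
    · obtain ⟨i, h8, h9⟩ := (hmem _).1 hcon
      exact h6 i h8 h9
    · by_contra hcon
      have hbn : b < n := hbe.trans e.1.2
      have h8 := h7 _ _ (havail ⟨b, hbn⟩ hb hcon)
      have h9 := hpos_enq (enq ⟨b, hbn⟩ hb) e hb (Fin.lt_def.2 hbe)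
      omega

/-! ### Induction on the number of `Dequeue` instances -/

/-- Two scenarios in which the processes before `k` return the same values, while process `k`
returns the first other value in the first scenario, but not in the second. The two differ only
in what process `k` can learn at time `P.chain k` or later. -/
structure Stage (P : Schedule V) (A : UniformAlgorithm.{v, w} V) (n : ℕ) (k : ℕ)
    (I J I' J' : Set ℕ) : Prop where
  le_of_mem : ∀ i ∈ I, i ≤ k
  le_of_mem' : ∀ i ∈ I', i ≤ k
  lt_of_mem : ∀ i ∈ J, i < k
  lt_of_mem' : ∀ i ∈ J', i < k
  invoke_iff : ∀ i, (i ∈ I ↔ i ∈ I') ∨ (i = 0 ∧ k = 0)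
  slow_iff : ∀ i, (i ∈ J ↔ i ∈ J') ∨ i + 1 = k
  returns_iff : ∀ i < k, ∀ v, P.Returns A n I J i v ↔ P.Returns A n I' J' i v
  differ : ∃ v, P.Returns A n I J k v ∧ P.IsFirstNotIn (P.before A n I J k) v ∧
    ¬ P.Returns A n I' J' k v

lemma Good.exists_stage_zero (h : P.Good A n u) (h0 : 0 < P.size) :
    P.Stage A n 0 {0} ∅ ∅ ∅ := by
  refine ⟨by simp, by simp, by simp, by simp, ?_, by simp, by simp, ?_⟩
  · intro i
    by_cases hi : i = 0 <;> simp [hi]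
  · obtain ⟨v, h1, h2⟩ := h.exists_last_returns (I := {0}) (J := ∅) h0 (by simp) (by simp) (by simp)
    refine ⟨v, h1, h2, ?_⟩
    rintro ⟨q, L, t, hq, hL, h3, -⟩
    obtain ⟨t₀, op, h4, -⟩ := h3.invoke_le hL
    simp [scenario, hq, h0] at h4

/-- Adding a `Dequeue` at process `k + 1` does not change the values returned by the processes up
to `k`, which respond before a message with delay `P.d` from process `k + 1` arrives. -/
lemma Good.returns_insert_iff (h : P.Good A n u) {k i : ℕ} (hi : i ≤ k) (v : Option V) :
    P.Returns A n I J i v ↔ P.Returns A n (insert (k + 1) I) J i v := by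
  refine h.returns_iff (p := k + 1) (B := P.deq (k + 1)) False (fun j => ?_) (by simp) (by simp)
    ?_ v
  · by_cases hj : j = k + 1
    · right; rw [horizon, if_pos hj, hj]
    · left; simp [hj]
  · rw [horizon, if_neg (by omega), if_pos (Or.inl (by omega))]
    have h1 := h.deq_mono hi
    have h2 := h.skew_lt
    have h3 := Good.deq_succ (P := P) k
    linarith

/-- Slow messages from process `k` to process `k + 1` do not change the values returned by
the processes up to `k`. -/
lemma Good.returns_slow_iff (h : P.Good A n u) {k i : ℕ} (hi : i ≤ k) (v : Option V) :
    P.Returns A n I J i v ↔ P.Returns A n I (insert k J) i v := by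
  refine h.returns_iff (p := k + 1) (B := P.chain (k + 1)) False (by simp) (fun j => ?_) (by simp)
    ?_ v
  · by_cases hj : j = k
    · right; rw [hj, Good.chain_succ]; exact ⟨rfl, le_rfl⟩
    · left; simp [hj]
  · rw [horizon, if_neg (by omega), if_pos (Or.inl (by omega))]
    have h1 := h.deq_mono hi
    have h2 := h.deq_le_chain k
    have h3 := Good.chain_succ (P := P) k
    have h4 := h.gap_lt
    have h5 := h.skew_lt
    linarith

/-- In a stage, a sequential `Dequeue` at process `k + 1` returns different values: in the second
scenario, it returns the value returned by process `k` in the first. -/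
lemma Stage.exists_values (hS : P.Stage A n k I J I' J') (h : P.Good A n u)
    (hk : k + 1 < P.size) :
    ∃ a b, a ≠ b ∧ P.Returns A n (insert (k + 1) I) J (k + 1) a ∧
      P.IsFirstNotIn (P.before A n (insert (k + 1) I) J (k + 1)) a ∧
      P.Returns A n (insert (k + 1) I') J' (k + 1) b ∧
      P.IsFirstNotIn (P.before A n (insert (k + 1) I') J' (k + 1)) b := by
  obtain ⟨v, h1, ⟨c, hc, rfl, hc1, hc2⟩, h3⟩ := hS.differ
  obtain ⟨a, ha, ha'⟩ := h.exists_last_returns (I := insert (k + 1) I) (J := J) hk (by simp)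
    (by
      rintro i (rfl | hi)
      · exact le_rfl
      · exact (hS.le_of_mem i hi).trans k.le_succ)
    (fun i hi => by have := hS.lt_of_mem i hi; omega)
  obtain ⟨b, hb, hb'⟩ := h.exists_last_returns (I := insert (k + 1) I') (J := J') hk (by simp)
    (by
      rintro i (rfl | hi)
      · exact le_rfl
      · exact (hS.le_of_mem' i hi).trans k.le_succ)
    (fun i hi => by have := hS.lt_of_mem' i hi; omega)
  refine ⟨a, b, ?_, ha, ha', hb, hb'⟩
  rintro rfl
  obtain ⟨a, has, rfl, ha1, ha2⟩ := ha'
  obtain ⟨b, hbs, hab, hb1, hb2⟩ := hb'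
  obtain rfl := h.arg_injective (Option.some.inj hab)
  rcases lt_trichotomy a c with hac | rfl | hac
  · obtain ⟨i, hi, hv⟩ := hc2 a has hac
    exact ha1 ⟨i, by omega, (h.returns_insert_iff hi.le _).1 hv⟩
  · exact ha1 ⟨k, by omega, (h.returns_insert_iff le_rfl _).1 h1⟩
  · obtain ⟨i, hi, hv⟩ := hb2 c hc hac
    have hv' := (h.returns_insert_iff (Nat.lt_succ_iff.1 hi) _).2 hv
    rcases Nat.lt_succ_iff_lt_or_eq.1 hi with hi | rfl
    · exact hc1 ⟨i, hi, (hS.returns_iff i hi _).2 hv'⟩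
    · exact h3 hv'

lemma Stage.horizon_le (hS : P.Stage A n k I J I' J') (e : Prop) (i : ℕ) :
    (i ∈ insert (k + 1) I ↔ i ∈ insert (k + 1) I') ∨
      P.horizon k (P.chain k) e i ≤ P.deq i := by
  rcases hS.invoke_iff i with h1 | ⟨rfl, rfl⟩
  · left; simp [h1]
  · right; simp [horizon, chain, deq]

/-- From a pair of scenarios at stage `k` to one at stage `k + 1`: make the messages slow by which
process `k + 1` learns which scenario of the pair it is in. Then it returns the same value in
both, so making them slow makes a difference in at least one of the two. -/
lemma Stage.succ (hS : P.Stage A n k I J I' J') (h : P.Good A n u) (hk : k + 1 < P.size) :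
    ∃ I J I' J', P.Stage A n (k + 1) I J I' J' := by
  obtain ⟨a, b, hab, ha, ha', hb, hb'⟩ := hS.exists_values h hk
  obtain ⟨y, hy⟩ := h.exists_returns (I := insert (k + 1) I) (J := insert k J) hk (by simp)
  have hy' : P.Returns A n (insert (k + 1) I') (insert k J') (k + 1) y := by
    refine (h.returns_iff (p := k) (B := P.chain k) True (hS.horizon_le True) (fun i => ?_)
      (by simp) ?_ y).1 hy
    · rcases hS.slow_iff i with h1 | h1
      · left; simp [h1]
      · right
        subst h1
        exact ⟨rfl, (Good.chain_succ i).le⟩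
    · rw [horizon, if_neg (by omega), if_pos (Or.inr ⟨trivial, rfl⟩), Good.deq_succ]
      have h1 := h.deq_le_chain k
      have h2 := h.two_mul_gap_le
      linarith
  -- the next stage, for any of the two scenarios in which the slow messages make a difference
  have next : ∀ I J, (∀ i ∈ I, i ≤ k) → (∀ i ∈ J, i < k) → ∀ a, a ≠ y →
      P.Returns A n (insert (k + 1) I) J (k + 1) a →
      P.IsFirstNotIn (P.before A n (insert (k + 1) I) J (k + 1)) a →
      P.Returns A n (insert (k + 1) I) (insert k J) (k + 1) y →
      P.Stage A n (k + 1) (insert (k + 1) I) J (insert (k + 1) I) (insert k J) := by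
    intro I J hI hJ a hay ha ha' hy
    have hI' : ∀ i ∈ insert (k + 1) I, i ≤ k + 1 := by
      rintro i (rfl | hi)
      · exact le_rfl
      · exact (hI i hi).trans k.le_succ
    refine ⟨hI', hI', fun i hi => (hJ i hi).trans k.lt_succ_self, ?_, by simp, fun i => ?_,
      fun i hi v => h.returns_slow_iff (Nat.lt_succ_iff.1 hi) v,
      a, ha, ha', fun hcon => hay (h.returns_unique hcon hy)⟩
    · rintro i (rfl | hi)
      · exact i.lt_succ_self
      · exact (hJ i hi).trans k.lt_succ_self
    · by_cases hi : i = k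
      · right; rw [hi]
      · left; simp [hi]
  by_cases hay : a = y
  · exact ⟨_, _, _, _, next I' J' hS.le_of_mem' hS.lt_of_mem' b
      (fun hby => hab (hay.trans hby.symm)) hb hb' hy'⟩
  · exact ⟨_, _, _, _, next I J hS.le_of_mem hS.lt_of_mem a hay ha ha' hy⟩

/-- If process `k + 1` has to respond before it learns about the difference, there is no stage. -/
lemma Stage.false (hS : P.Stage A n k I J I' J') (h : P.Good A n u) (hk : k + 1 < P.size)
    (hlt : (k + 2) * P.gap ≤ (k + 1) * P.d) : False := by
  obtain ⟨a, b, hab, ha, -, hb, -⟩ := hS.exists_values h hk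
  refine hab (h.returns_unique ((h.returns_iff (p := k) (B := P.chain k) False (hS.horizon_le False)
    (fun i => ?_) (by simp) ?_ a).1 ha) hb)
  · rcases hS.slow_iff i with h1 | h1
    · exact Or.inl h1
    · right
      subst h1
      exact ⟨rfl, (Good.chain_succ i).le⟩
  · rw [horizon, if_neg (by omega), if_neg (by simp)]
    simp only [deq, chain]
    push_cast
    linarith

/-- The lower bounds `(k + 1) / (k + 2) * d` for `Dequeue`, as long as there are enough
processes. -/
theorem Good.lt_gap (h : P.Good A n u) {k : ℕ} (hk : k + 1 < P.size) :
    (k + 1) * P.d < (k + 2) * P.gap := by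
  have hstage : ∀ j ≤ k, ∃ I J I' J', P.Stage A n j I J I' J' := by
    intro j
    induction j with
    | zero => exact fun _ => ⟨_, _, _, _, h.exists_stage_zero (by omega)⟩
    | succ j ih =>
      intro hj
      obtain ⟨I, J, I', J', hS⟩ := ih (by omega)
      exact hS.succ h (by omega)
  obtain ⟨I, J, I', J', hS⟩ := hstage k le_rfl
  by_contra hcon
  exact hS.false h hk (not_lt.1 hcon)

end Schedule

/-! ### The choice of the parameters -/

/-- Times for successive invocations of `Enqueue` at the processes from `M` on, each more than
`σ` after the response to the one before, so that they stay in this order under shifts by `σ`. -/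
lemma exists_enqueue_times {d u σ : ℝ} (hA : A.IsSetLinearizableImplementation d u) (hσ : 0 ≤ σ)
    (hσd : σ < d) (hσu : σ ≤ u) (hσn : σ ≤ (1 - 1 / (n : ℝ)) * u) {arg : ℕ → V}
    (harg : Function.Injective arg) {M m : ℕ} (hMm : M ≤ m) (hmn : m ≤ n) :
    ∃ (enq resp : ℕ → ℝ) (B : ℝ), (∀ i, M ≤ i → i < m → resp i + σ < B) ∧
      (∀ i j, M ≤ i → i < j → j < m → resp i + σ < enq j) ∧
      ∀ (S : Scenario V n) L, IsHistory A S L → (∀ i j t, d - σ ≤ S.delay i j t) →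
        (∀ i t op, t < B → (S.invoke i = some (t, op) ↔
          M ≤ (i : ℕ) ∧ (i : ℕ) < m ∧ t = enq i ∧ op = .enqueue (arg i))) →
        (∀ i j t, t < B → S.delay i j t = if j ≤ i then d else d - σ) →
        ∀ i : Fin n, M ≤ (i : ℕ) → (i : ℕ) < m → ∃ r, Answers A i (L i) r (resp i) := by
  induction m, hMm using Nat.le_induction with
  | base =>
    exact ⟨fun _ => 0, fun _ => 0, 0, fun i h1 h2 => by omega, fun i j h1 h2 h3 => by omega,
      fun S L _ _ _ _ i h1 h2 => by omega⟩
  | succ m hMm ih =>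
    obtain ⟨enq, resp, B, h1, h2, h3⟩ := ih (by omega)
    let enq' := Function.update enq m B
    have henq' : ∀ i < m, enq' i = enq i := fun i hi => Function.update_of_ne hi.ne _ _
    have henqm : enq' m = B := Function.update_self _ _ _
    let E : Scenario V n := ⟨fun i => if M ≤ (i : ℕ) ∧ (i : ℕ) < m + 1 then
      some (enq' i, .enqueue (arg i)) else none, fun i j _ => if j ≤ i then d else d - σ⟩
    have hE : ∀ i t op, E.invoke i = some (t, op) ↔
        M ≤ (i : ℕ) ∧ (i : ℕ) < m + 1 ∧ t = enq' i ∧ op = .enqueue (arg i) := by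
      intro i t op
      simp only [E]
      split_ifs with hi
      · simp [hi.1, hi.2, eq_comm]
      · simp only [false_iff]
        exact fun h => hi ⟨h.1, h.2.1⟩
    have hEd : ∀ i j t, d - σ ≤ E.delay i j t := by
      intro i j t
      simp only [E]
      split_ifs <;> linarith
    have hEv : E.Valid (fun _ => 0) d u := by
      refine ⟨fun i j => by linarith, fun i j t => ?_, fun i j t => ?_, fun i j t => ?_, ?_⟩
      · have := hEd i j t
        linarith
      · have := hEd i j t
        linarith
      · simp only [E]
        split_ifs <;> linarith
      · intro i j t t' x hi hj
        obtain ⟨-, -, -, hx⟩ := (hE _ _ _).1 hi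
        obtain ⟨-, -, -, hy⟩ := (hE _ _ _).1 hj
        rw [hx] at hy
        exact Fin.ext (harg (Op.enqueue.inj hy))
    obtain ⟨L, hL, hO⟩ := exists_outcome hA (by omega) hEv
    let q : Fin n := ⟨m, by omega⟩
    have hq : E.invoke q = some (B, .enqueue (arg m)) :=
      (hE _ _ _).2 ⟨hMm, m.lt_succ_self, henqm.symm, rfl⟩
    obtain ⟨inst, pos, h4, -, -⟩ := hO.linearizable
    obtain ⟨-, -, r, tq, -, hr, -⟩ := h4 ⟨q, by simp [hq]⟩
    let resp' := Function.update resp m tq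
    have hresp' : ∀ i < m, resp' i = resp i := fun i hi => Function.update_of_ne hi.ne _ _
    have hrespm : resp' m = tq := Function.update_self _ _ _
    have hB1 : B ≤ max B tq := le_max_left _ _
    have hB2 : tq ≤ max B tq := le_max_right _ _
    refine ⟨enq', resp', max B tq + σ + 1, fun i hMi hi => ?_, fun i j hMi hij hj => ?_, ?_⟩
    · rcases Nat.lt_succ_iff_lt_or_eq.1 hi with hi | rfl
      · have := h1 i hMi hi
        rw [hresp' i hi]
        linarith
      · rw [hrespm]
        linarith
    · rcases Nat.lt_succ_iff_lt_or_eq.1 hj with hj | rfl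
      · rw [hresp' i (hij.trans hj), henq' j hj]
        exact h2 i j hMi hij hj
      · rw [hresp' i hij, henqm]
        exact h1 i hMi hij
    · intro S L' hL' hSd hSi hSb i hMi hi
      rcases Nat.lt_succ_iff_lt_or_eq.1 hi with hi | hi
      · rw [hresp' i hi]
        refine h3 S L' hL' hSd (fun i t op ht => ?_)
          (fun i j t ht => hSb i j t (by linarith)) i hMi hi
        rw [hSi i t op (by linarith)]
        constructor
        · rintro ⟨h5, h6, rfl, rfl⟩
          rcases Nat.lt_succ_iff_lt_or_eq.1 h6 with h6 | h6
          · exact ⟨h5, h6, henq' _ h6, rfl⟩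
          · rw [h6, henqm] at ht
            exact absurd ht (lt_irrefl _)
        · rintro ⟨h5, h6, rfl, rfl⟩
          exact ⟨h5, by omega, (henq' _ h6).symm, rfl⟩
      · obtain rfl : i = q := Fin.ext hi
        have hδ : 0 < d - σ := by linarith
        rw [hi, hrespm]
        refine ⟨r, hr.of_indist (β := fun _ => max B tq + σ + 1) hL hL' ?_ ?_ hδ hEd hSd
          (by linarith)⟩
        · refine ⟨fun i t op ht h => (hSi i t op ht).2 ((hE i t op).1 h), fun j i t ht => ?_⟩
          have h5 := hEd j i t
          have h6 : t < max B tq + σ + 1 := by linarith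
          exact ⟨h6, hSb j i t h6⟩
        · refine ⟨fun i t op ht h => (hE i t op).2 ((hSi i t op ht).1 h), fun j i t ht => ?_⟩
          have h5 := hSd j i t
          have h6 : t < max B tq + σ + 1 := by linarith
          exact ⟨h6, (hSb j i t h6).symm⟩

lemma exists_good_schedule [Infinite V] {d u σ c : ℝ} (hA : A.IsSetLinearizableImplementation d u)
    (hσ : 0 ≤ σ) (hσd : σ < d) (hσu : σ ≤ u) {M : ℕ}
    (hσn : σ ≤ (1 - 1 / ((2 * M : ℕ) : ℝ)) * u) (hσc : σ ≤ c) (hc : 2 * c ≤ d + σ)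
    (hAc : A.dequeueTime d u < ENNReal.ofReal c) :
    ∃ P : Schedule V, P.Good A (2 * M) u ∧ P.size = M ∧ P.d = d ∧ P.gap = c := by
  have harg := (Infinite.natEmbedding V).injective
  obtain ⟨enq, resp, B, h1, h2, h3⟩ :=
    exists_enqueue_times hA hσ hσd hσu hσn harg (M := M) (m := 2 * M) (by omega) le_rfl
  refine ⟨⟨M, d, σ, c, B, enq, Infinite.natEmbedding V⟩,
    ⟨hA, le_rfl, hσ, hσn, hσu, hσd, hσc, hc, hAc, harg, ?_⟩, rfl, rfl, rfl⟩
  intro I J L hL i hi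
  have hdelay : ∀ i j t, d - σ ≤ (Schedule.scenario
      ⟨M, d, σ, c, B, enq, Infinite.natEmbedding V⟩ (2 * M) I J).delay i j t := by
    intro i j t
    simp only [Schedule.scenario]
    split_ifs <;> linarith
  suffices h : ∃ r, Answers A i (L i) r (resp i) by
    obtain ⟨r, hr⟩ := h
    exact ⟨r, _, hr, h1 i hi i.2, fun j hij => h2 i j hi hij j.2⟩
  refine h3 _ L hL hdelay (fun i t op ht => ?_) (fun i j t ht => ?_) i hi i.2
  · constructor
    · intro h
      cases op with
      | enqueue x =>
        obtain ⟨h4, rfl, rfl⟩ := Schedule.invoke_eq_enqueue h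
        exact ⟨h4, i.2, rfl, rfl⟩
      | dequeue =>
        obtain ⟨-, -, rfl⟩ := Schedule.invoke_eq_dequeue h
        have : 0 ≤ ((i : ℕ) : ℝ) * (c - σ) := mul_nonneg (Nat.cast_nonneg _) (by linarith)
        simp only [Schedule.deq] at ht
        linarith
    · rintro ⟨h4, -, rfl, rfl⟩
      exact Schedule.invoke_enqueue h4
  · have : 0 ≤ ((i : ℕ) : ℝ) * (d - σ) := mul_nonneg (Nat.cast_nonneg _) (by linarith)
    have h4 : ¬ B + ((i : ℕ) : ℝ) * (d - σ) ≤ t := by linarith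
    simp [Schedule.scenario, Schedule.chain, h4]

theorem le_dequeueTime [Infinite V] {d u : ℝ} (hu : 0 ≤ u) (hud : u ≤ d)
    (hA : A.IsSetLinearizableImplementation d u) :
    ENNReal.ofReal ((d + u) / 2) ≤ A.dequeueTime d u := by
  by_contra hcon
  obtain ⟨c₀, -, hc₁, hc₂⟩ := ENNReal.lt_iff_exists_real_btwn.1 (not_le.1 hcon)
  obtain ⟨hc₃, hpos⟩ := ENNReal.ofReal_lt_ofReal_iff'.1 hc₂
  have hd : 0 < d := by linarith
  -- the shift `σ` is less than `u`, as the admissible skew is less than `u` in every system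
  obtain ⟨σ, hσ, hσd, hσu, hcσ, N, hN⟩ : ∃ σ : ℝ, 0 ≤ σ ∧ σ < d ∧ σ ≤ u ∧ 2 * c₀ ≤ d + σ ∧
      ∃ N : ℕ, ∀ n : ℕ, N ≤ n → σ ≤ (1 - 1 / (n : ℝ)) * u := by
    rcases hu.eq_or_lt with rfl | hu
    · exact ⟨0, le_rfl, hd, le_rfl, by linarith, 0, fun n _ => by simp⟩
    · have h1 := le_max_left 0 ((2 * c₀ - d + u) / 2)
      have h2 := le_max_right 0 ((2 * c₀ - d + u) / 2)
      have h3 : max 0 ((2 * c₀ - d + u) / 2) < u := max_lt hu (by linarith)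
      set σ := max 0 ((2 * c₀ - d + u) / 2)
      refine ⟨σ, h1, by linarith, h3.le, by linarith, ?_⟩
      obtain ⟨N, hN⟩ := exists_nat_gt (u / (u - σ))
      have hσ' : 0 < u - σ := by linarith
      refine ⟨N, fun n hn => ?_⟩
      have hn' : u / (u - σ) < n := hN.trans_le (by exact_mod_cast hn)
      have hn0 : (0 : ℝ) < n := (div_nonneg hu.le hσ'.le).trans_lt hn'
      rw [div_lt_iff₀ hσ'] at hn'
      have h4 : u / n ≤ u - σ := by
        rw [div_le_iff₀ hn0]
        linarith
      have h5 : (1 - 1 / (n : ℝ)) * u = u - u / n := by ring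
      linarith
  have hσc : σ ≤ max c₀ σ := le_max_right _ _
  have hc : 2 * max c₀ σ ≤ d + σ := by
    rcases max_choice c₀ σ with h | h <;> rw [h] <;> linarith
  have hAc : A.dequeueTime d u < ENNReal.ofReal (max c₀ σ) :=
    hc₁.trans_le (ENNReal.ofReal_le_ofReal (le_max_left _ _))
  set c := max c₀ σ
  have hcd : 0 < d - c := by linarith
  obtain ⟨k, hk⟩ := exists_nat_gt ((2 * c - d) / (d - c))
  rw [div_lt_iff₀ hcd] at hk
  obtain ⟨P, hP, hPs, hPd, hPc⟩ := exists_good_schedule hA hσ hσd hσu (M := k + 2 + N)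
    (hN _ (by omega)) hσc hc hAc
  have := hP.lt_gap (k := k) (by omega)
  rw [hPd, hPc] at this
  linarith

end MultiplicityQueue

theorem mainTheorem2 {V : Type*} [Infinite V] (d u : ℝ) (hu : 0 ≤ u) (hud : u ≤ d)
    (A : MultiplicityQueue.UniformAlgorithm V) (hA : A.IsSetLinearizableImplementation d u) :
    ENNReal.ofReal ((d + u) / 2) ≤ A.dequeueTime d u ∧
      min (2 * d / 3) ((d + u) / 2) ≤ (d + u) / 2 :=
  ⟨MultiplicityQueue.le_dequeueTime hu hud hA, min_le_right _ _⟩
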